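/- Conventions. The second coordinate of a point of the plane is its height. A bounded open set $S\subset\mathbb R^2$ (not necessarily connected, nonempty, equal to the interior of its closure) whose boundary $\partial S$ is a disjoint union of finitely many simple closed polygons is called a domain. An arc is a broken line without self-intersection with two distinct ends. It is a crossing (type $C$) if the ends of its height range are the heights of its two ends; it has type $B$ (resp. $D$) if both its ends have the same height $h$ and it lies in the half-plane of heights $\ge h$ (resp. $\le h$). A number $c$ is a critical height of $\partial S$ if some subarc of $\partial S$ attains its maximal or its minimal height at the value $c$ while none of its ends has height $c$. For $h<H$, the band $[h,H]$ (the set of points of height between $h$ and $H$) is unicritical if $h,H$ are not critical and $[h,H]$ contains at most one critical height. The crossing components of a band are the maximal crossing subarcs of the part $\partial S[h,H]$ of $\partial S$ in the band. The lower (upper) position of a crossing component is the number of crossing components whose end on the level $h$ (resp. $H$) lies to the left of its end on that level, and is $0$ if it has no end there. In a unicritical band, of two disjoint crossing components the left one is the one whose intersection with the critical level (with any inner level, if there is no critical one) lies to the left; of two distinct intersecting ones, whose union is then an arc of type $B$ or $D$, the left one is the one with the smaller lower position for type $B$, and with the smaller upper position for type $D$. The position of a crossing component is the number of crossing components on its left.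 The string of a unicritical band lists the crossing components by increasing position and writes for each of them the type ($B$, $C$ or $D$) of the connected component of $\partial S[h,H]$ that contains it. If $h_0>h_1>\dots>h_m$ are such that $S$ lies in the band $[h_m,h_0]$ and all bands $[h_{k},h_{k-1}]$ are unicritical, then the strings of the bands $[h_1,h_0],[h_2,h_1],\dots,[h_m,h_{m-1}]$, in this order and separated by the symbol $;$, form a CRIPT-code of $S$. A word over $\{B,C,D,;\}$ is correct if it is a CRIPT-code of some domain, for some such choice of levels. For a word $w$, let $w[1],\dots,w[n]$ be its (possibly empty) strings, i.e. the blocks between consecutive separators, and let $B(v),C(v),D(v)$ denote the numbers of letters $B,C,D$ in $v$. Theorem. Let $w$ be a word over the alphabet $\{B,C,D,;\}$ such that 1. (boundary conditions) $B(w[1])>0$ and $C(w[1])=D(w[1])=0$; $D(w[n])>0$ and $B(w[n])=C(w[n])=0$; 2. (evenness conditions) for each $T\in\{B,D\}$: whenever an occurrence of $T$ in $w$ is preceded in $w$ by an even number of letters $T$, it is not the last symbol of $w$ and the next symbol of $w$ is again $T$; 3. (balance conditions) $B(w[k])+C(w[k])=D(w[k+1])+C(w[k+1])$ for every $1\le k<n$.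 Then $w$ is correct: there are a domain $S$ and levels $h_0>\dots>h_m$ as above such that the corresponding CRIPT-code of $S$ is $w$. -/

import Mathlib

namespace Cript

/-! ### Words of the alphabet `{B, C, D, ;}` -/

/-- The alphabet; `sep` is the separator `;`. -/
inductive Symbol where
  | B
  | C
  | D
  | sep
  deriving DecidableEq

/-- The strings of a word: the maximal blocks between separators (blocks may be empty). -/
def strings (w : List Symbol) : List (List Symbol) := w.splitOn Symbol.sep

/-- The `k`-th string of a word, counted from `0` (empty if there is no such string). -/
def stringAt (w : List Symbol) (k : ℕ) : List Symbol := (strings w).getD k []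

/-- The number of strings, i.e. the number of separators plus one. -/
def numStrings (w : List Symbol) : ℕ := (strings w).length

/-- The first string is a nonempty string of `B`s, the last one a nonempty string of `D`s. -/
def BoundaryConditions (w : List Symbol) : Prop :=
  (0 < (stringAt w 0).count Symbol.B ∧
    (stringAt w 0).count Symbol.C = 0 ∧
    (stringAt w 0).count Symbol.D = 0) ∧
  (0 < (stringAt w (numStrings w - 1)).count Symbol.D ∧
    (stringAt w (numStrings w - 1)).count Symbol.C = 0 ∧
    (stringAt w (numStrings w - 1)).count Symbol.B = 0)

/-- If a letter `t` of `w` is preceded in `w` by an even number of letters `t`, then the next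
symbol of `w` exists and is again `t`. -/
def EvennessFor (t : Symbol) (w : List Symbol) : Prop :=
  ∀ i : ℕ, w[i]? = some t → Even ((w.take i).count t) → w[i + 1]? = some t

def EvennessConditions (w : List Symbol) : Prop :=
  EvennessFor Symbol.B w ∧ EvennessFor Symbol.D w

def BalanceConditions (w : List Symbol) : Prop :=
  ∀ k : ℕ, k + 1 < numStrings w →
    (stringAt w k).count Symbol.B + (stringAt w k).count Symbol.C =
      (stringAt w (k + 1)).count Symbol.D + (stringAt w (k + 1)).count Symbol.C

/-! ### Arcs and their height types -/

/-- The plane; the second coordinate is the height. -/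
abbrev Plane : Type := ℝ × ℝ

/-- `A` is a (nonclosed) arc with ends `p` and `q`. Inside a piecewise linear set these are
exactly the broken lines without self-intersection. -/
def IsArc (A : Set Plane) (p q : Plane) : Prop :=
  ∃ γ : ℝ → Plane, ContinuousOn γ (Set.Icc 0 1) ∧ Set.InjOn γ (Set.Icc 0 1) ∧
    γ '' Set.Icc 0 1 = A ∧ γ 0 = p ∧ γ 1 = q

/-- `p` is an end of the arc `A`. -/
def IsEnd (A : Set Plane) (p : Plane) : Prop := ∃ q, IsArc A p q

/-- The ends of the height range of the arc are the heights of its ends. -/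
def IsCrossing (A : Set Plane) : Prop :=
  ∃ p q, IsArc A p q ∧ ∀ x ∈ A, p.2 ≤ x.2 ∧ x.2 ≤ q.2

/-- Type `B`: both ends lie on one level and the arc lies in the upper semiplane of it. -/
def IsBirth (A : Set Plane) : Prop :=
  ∃ p q, IsArc A p q ∧ p.2 = q.2 ∧ ∀ x ∈ A, p.2 ≤ x.2

/-- Type `D`: both ends lie on one level and the arc lies in the lower semiplane of it. -/
def IsDeath (A : Set Plane) : Prop :=
  ∃ p q, IsArc A p q ∧ p.2 = q.2 ∧ ∀ x ∈ A, x.2 ≤ p.2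

/-- The height type of an arc. -/
def HasType (A : Set Plane) : Symbol → Prop
  | Symbol.B => IsBirth A
  | Symbol.C => IsCrossing A
  | Symbol.D => IsDeath A
  | Symbol.sep => False

/-- The arc `A` touches the level `c`: the number `c` is an end of its height range, but not the
height of one of its ends. -/
def Touches (A : Set Plane) (c : ℝ) : Prop :=
  ∃ p q, IsArc A p q ∧ p.2 ≠ c ∧ q.2 ≠ c ∧ (∃ x ∈ A, x.2 = c) ∧
    ((∀ x ∈ A, c ≤ x.2) ∨ (∀ x ∈ A, x.2 ≤ c))

/-- `c` is a critical height of the curve `K`: some subarc of `K` touches the level `c`. -/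
def IsCritical (K : Set Plane) (c : ℝ) : Prop := ∃ A, A ⊆ K ∧ Touches A c

/-! ### Domains with piecewise linear boundary -/

/-- `K` is a disjoint union of finitely many simple closed polygons: a finite union of
nondegenerate segments that meet only in common endpoints, each endpoint belonging to exactly
two of the segments. -/
def IsPolygonalCurve (K : Set Plane) : Prop :=
  ∃ E : Set (Plane × Plane), E.Finite ∧
    K = ⋃ e ∈ E, segment ℝ e.1 e.2 ∧
    (∀ e ∈ E, e.1 ≠ e.2) ∧
    (∀ e ∈ E, ∀ f ∈ E, e ≠ f →
      segment ℝ e.1 e.2 ∩ segment ℝ f.1 f.2 ⊆ {e.1, e.2} ∩ {f.1, f.2}) ∧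
    (∀ e ∈ E, ∀ v : Plane, v = e.1 ∨ v = e.2 →
      {f | f ∈ E ∧ (v = f.1 ∨ v = f.2)}.ncard = 2)

/-- A bounded plane domain, not necessarily connected, whose boundary is a disjoint union of
finitely many simple closed polygons. The condition `interior (closure S) = S` says that near its
boundary the domain lies on one side only. It has finitely many connected components, because
its boundary is a finite union of segments. -/
structure IsPlaneDomain (S : Set Plane) : Prop where
  nonempty : S.Nonempty
  isOpen : IsOpen S
  isBounded : Bornology.IsBounded S
  regular : interior (closure S) = S
  boundary : IsPolygonalCurve (frontier S)

/-- The part of the boundary of `S` in the horizontal band between the levels `h` and `H`. -/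
def bandBoundary (S : Set Plane) (h H : ℝ) : Set Plane :=
  {p | p ∈ frontier S ∧ h ≤ p.2 ∧ p.2 ≤ H}

/-- The band `[h, H]` is regular (`h` and `H` are not critical) and contains at most one critical
height of the boundary of `S`. -/
def IsUnicritical (S : Set Plane) (h H : ℝ) : Prop :=
  h < H ∧ ¬ IsCritical (frontier S) h ∧ ¬ IsCritical (frontier S) H ∧
    {c | c ∈ Set.Icc h H ∧ IsCritical (frontier S) c}.Subsingleton

/-- Crossing components of the boundary of `S` in the band: the maximal crossing subarcs. -/
def IsCrossingComponent (S : Set Plane) (h H : ℝ) (A : Set Plane) : Prop :=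
  A ⊆ bandBoundary S h H ∧ IsCrossing A ∧
    ∀ A', A ⊆ A' → A' ⊆ bandBoundary S h H → IsCrossing A' → A' = A

/-- The number of crossing components of the band that have an end on the level `c` lying to the
left of an end of `A` on the level `c` (so it is `0` if `A` has no end on that level). For
`c = h` this is the lower position, for `c = H` the upper position of `A`. -/
noncomputable def endPosition (S : Set Plane) (h H c : ℝ) (A : Set Plane) : ℕ :=
  {A' | IsCrossingComponent S h H A' ∧
    ∃ p q, IsEnd A p ∧ p.2 = c ∧ IsEnd A' q ∧ q.2 = c ∧ q.1 < p.1}.ncard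

noncomputable def lowerPosition (S : Set Plane) (h H : ℝ) (A : Set Plane) : ℕ :=
  endPosition S h H h A

noncomputable def upperPosition (S : Set Plane) (h H : ℝ) (A : Set Plane) : ℕ :=
  endPosition S h H H A

/-- The crossing component `A₁` is on the left from `A₂`; here `g` is the critical level of the
band. Disjoint components are compared on the level `g`; intersecting ones form together an arc
of type `B` or `D` and are compared by lower, respectively upper, position. -/
def LeftOf (S : Set Plane) (h H g : ℝ) (A₁ A₂ : Set Plane) : Prop :=
  (Disjoint A₁ A₂ ∧ ∀ p ∈ A₁, ∀ q ∈ A₂, p.2 = g → q.2 = g → p.1 < q.1) ∨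
  (¬ Disjoint A₁ A₂ ∧ IsBirth (A₁ ∪ A₂) ∧ lowerPosition S h H A₁ < lowerPosition S h H A₂) ∨
  (¬ Disjoint A₁ A₂ ∧ IsDeath (A₁ ∪ A₂) ∧ upperPosition S h H A₁ < upperPosition S h H A₂)

/-- The position of a crossing component: the number of crossing components on its left. -/
noncomputable def position (S : Set Plane) (h H g : ℝ) (A : Set Plane) : ℕ :=
  {A' | IsCrossingComponent S h H A' ∧ LeftOf S h H g A' A}.ncard

/-- The connected component of the boundary part in the band that contains `A` has type `t`. -/
def HasComponentType (S : Set Plane) (h H : ℝ) (A : Set Plane) (t : Symbol) : Prop :=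
  ∃ x ∈ A, HasType (connectedComponentIn (bandBoundary S h H) x) t

/-- `u` is the string of the unicritical band `[h, H]`: the types of all crossing components,
listed by increasing position. The level `g` is the critical level of the band if there is one;
in an uncritical band it is any inner level (all of them give the same order). -/
def IsCriptString (S : Set Plane) (h H : ℝ) (u : List Symbol) : Prop :=
  IsUnicritical S h H ∧
  ∃ g ∈ Set.Ioo h H, (∀ c ∈ Set.Icc h H, IsCritical (frontier S) c → c = g) ∧
    ∃ l : List (Set Plane),
      (∀ A, A ∈ l ↔ IsCrossingComponent S h H A) ∧
      l.Pairwise (fun A₁ A₂ => position S h H g A₁ < position S h H g A₂) ∧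
      List.Forall₂ (HasComponentType S h H) l u

/-- The levels `h 0 > h 1 > ⋯ > h m` form a unicritical decomposition of `S`. -/
def IsUnicriticalDecomposition (S : Set Plane) {m : ℕ} (h : Fin (m + 1) → ℝ) : Prop :=
  StrictAnti h ∧ (∀ p ∈ S, h (Fin.last m) ≤ p.2 ∧ p.2 ≤ h 0) ∧
    ∀ k : Fin m, IsUnicritical S (h k.succ) (h k.castSucc)

/-- `w` is the code of `S` with respect to some unicritical decomposition: the strings of the
bands, in the order of decreasing level, separated by `;`. -/
def IsCriptCode (S : Set Plane) (w : List Symbol) : Prop :=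
  ∃ (m : ℕ) (h : Fin (m + 1) → ℝ) (s : Fin m → List Symbol),
    IsUnicriticalDecomposition S h ∧
    (∀ k : Fin m, IsCriptString S (h k.succ) (h k.castSucc) (s k)) ∧
    w = [Symbol.sep].intercalate (List.ofFn s)

/-- A word is correct if it is the code of some domain. -/
def IsCorrect (w : List Symbol) : Prop :=
  ∃ S : Set Plane, IsPlaneDomain S ∧ IsCriptCode S w

end Cript

namespace Cript

/-! The domain is built explicitly: every string of the word is drawn in its own horizontal band of
height 2, the bands are stacked, and the resulting closed polygonal curve is filled by parity.

In one band, each letter gives a strand from left to right in the order of the string: over the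
lower half for `B`, over the upper half for `D`, over both halves for `C`. Evenness splits the
letters `B`, and likewise the letters `D`, into pairs of neighbours inside one string, because a
separator can never follow the first letter of a pair. The two strands of a pair are joined on the
middle level (`midPos`), so every turn of the curve in the band happens at one height. On the outer
levels the strand ends are numbered consecutively from left to right (`rank`). Balance says that the
numbers of ends arriving at a common level from above and from below agree, so equal numbers can be
glued. The boundary conditions play the same role at the top and at the bottom, where the
neighbouring band is empty. Hence every vertex has degree 2 (`BandStrings.drawing`).

For any layered drawing with all degrees 0 or 2, the points with an odd number of strands on their
left form a bounded regular open set whose frontier is the whole curve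
(`Drawing.isPlaneDomain_region`): the parity is locally constant off the curve and changes across
each strand.

It remains to read the code back. Strands have strictly monotone height and are glued monotonically
on the outer levels, so only middle levels can be critical. `Strip` records the picture in one band;
from it follow that the crossing components are exactly the strands
(`Strip.isCrossingComponent_iff`), that the connected component of a strand has the type of its
letter (`Strip.hasComponentType_strand`), and that position increases with the place in the string
(`Strip.position_lt`). -/

open Set Filter Topology

/-! ### Layered drawings and the region they bound -/

/-- A plane drawing in horizontal layers: in the layer `[t, t + 1]` every strand `i ∈ strands t` is
the segment from `(bot t i, t)` to `(top t i, t + 1)`. Strands of a layer are ordered and meet only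
at the ends, and at each vertex exactly two strand ends meet. -/
structure Drawing where
  strands : ℤ → Finset ℕ
  bot : ℤ → ℕ → ℕ
  top : ℤ → ℕ → ℕ
  lo : ℤ
  hi : ℤ
  range_of_mem : ∀ t, ∀ i ∈ strands t, lo ≤ t ∧ t < hi
  exists_mem : ∃ t, (strands t).Nonempty
  mono : ∀ t, ∀ i ∈ strands t, ∀ j ∈ strands t, i < j →
    bot t i ≤ bot t j ∧ top t i ≤ top t j ∧ (bot t i < bot t j ∨ top t i < top t j)
  degree : ∀ t v, ((strands t).filter (bot t · = v)).card +
      ((strands (t - 1)).filter (top (t - 1) · = v)).card = 0 ∨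
    ((strands t).filter (bot t · = v)).card +
      ((strands (t - 1)).filter (top (t - 1) · = v)).card = 2

namespace Drawing

variable (D : Drawing)

/-- The abscissa of the line through a strand at the height `y`. -/
def X (t : ℤ) (i : ℕ) (y : ℝ) : ℝ := D.bot t i * (t + 1 - y) + D.top t i * (y - t)

/-- The pairs layer-strand. -/
def index : Set (ℤ × ℕ) := {x | x.2 ∈ D.strands x.1}

/-- A strand as a pair of ends. -/
def edge (x : ℤ × ℕ) : Plane × Plane :=
  (((D.bot x.1 x.2 : ℝ), (x.1 : ℝ)), ((D.top x.1 x.2 : ℝ), (x.1 : ℝ) + 1))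

/-- A strand as a set of points. -/
def seg (x : ℤ × ℕ) : Set Plane :=
  {p | x.1 ≤ p.2 ∧ p.2 ≤ x.1 + 1 ∧ p.1 = D.X x.1 x.2 p.2}

def curve : Set Plane := ⋃ x ∈ D.index, D.seg x

/-- The strands of the layer `t` that pass to the left of `p`. -/
noncomputable def below (t : ℤ) (p : Plane) : Finset ℕ :=
  (D.strands t).filter (D.X t · p.2 < p.1)

/-- The points of the complement of the curve with an odd number of strands on the left. -/
def region : Set Plane := {p | p ∉ D.curve ∧ Odd (D.below ⌊p.2⌋ p).card}

def outside : Set Plane := {p | p ∉ D.curve ∧ ¬ Odd (D.below ⌊p.2⌋ p).card}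

variable {D}

@[simp] lemma X_bot (t : ℤ) (i : ℕ) : D.X t i t = D.bot t i := by simp [X]

@[simp] lemma X_top (t : ℤ) (i : ℕ) : D.X t i (t + 1) = D.top t i := by simp [X]

lemma continuous_X (t : ℤ) (i : ℕ) : Continuous (D.X t i) := by
  unfold X; fun_prop

lemma mem_curve {p : Plane} : p ∈ D.curve ↔
    ∃ t, ∃ i ∈ D.strands t, (t : ℝ) ≤ p.2 ∧ p.2 ≤ t + 1 ∧ p.1 = D.X t i p.2 := by
  simp only [curve, seg, index, mem_iUnion, Prod.exists, Set.mem_ofPred_eq, exists_prop]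

lemma X_lt {t : ℤ} {i j : ℕ} (hi : i ∈ D.strands t) (hj : j ∈ D.strands t) (hij : i < j) {y : ℝ}
    (h1 : t < y) (h2 : y < t + 1) : D.X t i y < D.X t j y := by
  obtain ⟨h3, h4, h5⟩ := D.mono t i hi j hj hij
  have h3' : (D.bot t i : ℝ) ≤ D.bot t j := by exact_mod_cast h3
  have h4' : (D.top t i : ℝ) ≤ D.top t j := by exact_mod_cast h4
  unfold X
  rcases h5 with h5 | h5
  · have h5' : (D.bot t i : ℝ) < D.bot t j := by exact_mod_cast h5
    exact add_lt_add_of_lt_of_le (mul_lt_mul_of_pos_right h5' (by linarith))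
      (mul_le_mul_of_nonneg_right h4' (by linarith))
  · have h5' : (D.top t i : ℝ) < D.top t j := by exact_mod_cast h5
    exact add_lt_add_of_le_of_lt (mul_le_mul_of_nonneg_right h3' (by linarith))
      (mul_lt_mul_of_pos_right h5' (by linarith))

lemma eq_of_X_eq {t : ℤ} {i j : ℕ} (hi : i ∈ D.strands t) (hj : j ∈ D.strands t) {y : ℝ}
    (h1 : t < y) (h2 : y < t + 1) (h : D.X t i y = D.X t j y) : i = j := by
  rcases lt_trichotomy i j with hij | hij | hij
  · exact absurd h (X_lt hi hj hij h1 h2).ne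
  · exact hij
  · exact absurd h (X_lt hj hi hij h1 h2).ne'

lemma finite_index : D.index.Finite := by
  refine Set.Finite.subset ((Finset.Ico D.lo D.hi).sigma D.strands |>.finite_toSet.image
    fun x => (x.1, x.2)) ?_
  rintro ⟨t, i⟩ h
  exact ⟨⟨t, i⟩, by simpa using ⟨D.range_of_mem t i h, h⟩, rfl⟩

lemma isClosed_seg (x : ℤ × ℕ) : IsClosed (D.seg x) :=
  (isClosed_le continuous_const continuous_snd).inter
    ((isClosed_le continuous_snd continuous_const).inter
      (isClosed_eq continuous_fst ((continuous_X _ _).comp continuous_snd)))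

lemma isClosed_curve : IsClosed D.curve :=
  D.finite_index.isClosed_biUnion fun _ _ => isClosed_seg _

lemma exists_bound (D : Drawing) :
    ∃ R : ℕ, ∀ t, ∀ i ∈ D.strands t, D.bot t i < R ∧ D.top t i < R := by
  obtain ⟨R, hR⟩ := (D.finite_index.image fun x => max (D.bot x.1 x.2) (D.top x.1 x.2)).bddAbove
  refine ⟨R + 1, fun t i hi => ?_⟩
  have := hR ⟨(t, i), hi, rfl⟩
  simp only [sup_le_iff] at this
  omega

lemma X_mem_Icc {R : ℕ} (hR : ∀ t, ∀ i ∈ D.strands t, D.bot t i < R ∧ D.top t i < R)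
    {t : ℤ} {i : ℕ} (hi : i ∈ D.strands t) {y : ℝ} (h1 : t ≤ y) (h2 : y ≤ t + 1) :
    D.X t i y ∈ Ico (0 : ℝ) R := by
  obtain ⟨h3, h4⟩ := hR t i hi
  have h3' : (D.bot t i : ℝ) < R := by exact_mod_cast h3
  have h4' : (D.top t i : ℝ) < R := by exact_mod_cast h4
  have h5 : (0 : ℝ) ≤ D.bot t i := by positivity
  have h6 : (0 : ℝ) ≤ D.top t i := by positivity
  unfold X
  constructor
  · have := mul_nonneg h5 (by linarith : (0 : ℝ) ≤ t + 1 - y)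
    have := mul_nonneg h6 (by linarith : (0 : ℝ) ≤ y - t)
    linarith
  · rcases h1.eq_or_lt with rfl | h1
    · simpa using h3'
    · have := mul_le_mul_of_nonneg_right h3'.le (by linarith : (0 : ℝ) ≤ t + 1 - y)
      have := mul_lt_mul_of_pos_right h4' (by linarith : (0 : ℝ) < y - t)
      linarith

/-! ### Parity of the number of strands on the left of a point -/

/-- Group the strand ends on the level by their vertex: each vertex contributes 0 or 2. Thus the
counts just above and just below the level have the same parity. -/
lemma even_level (t : ℤ) (x : ℝ) :
    Even (((D.strands t).filter fun i => (D.bot t i : ℝ) < x).card +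
      ((D.strands (t - 1)).filter fun i => (D.top (t - 1) i : ℝ) < x).card) := by
  obtain ⟨R, hR⟩ := D.exists_bound
  have key : ∀ (J : Finset ℕ) (f : ℕ → ℕ), (∀ i ∈ J, f i < R) →
      (J.filter fun i => (f i : ℝ) < x).card =
        ∑ v ∈ (Finset.range R).filter (fun v : ℕ => (v : ℝ) < x),
          (J.filter (f · = v)).card := by
    intro J f hf
    rw [Finset.card_eq_sum_card_fiberwise (f := f)
      (t := (Finset.range R).filter (fun v : ℕ => (v : ℝ) < x))]
    · refine Finset.sum_congr rfl fun v hv => ?_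
      congr 1
      ext i
      simp only [Finset.mem_filter, Finset.mem_range] at hv ⊢
      constructor
      · rintro ⟨⟨h, -⟩, h'⟩
        exact ⟨h, h'⟩
      · rintro ⟨h, rfl⟩
        exact ⟨⟨h, hv.2⟩, rfl⟩
    · intro i hi
      simp only [Finset.coe_filter, Set.mem_ofPred_eq, Finset.mem_range] at hi ⊢
      exact ⟨hf i hi.1, hi.2⟩
  rw [key _ _ fun i hi => (hR _ i hi).1, key _ _ fun i hi => (hR _ i hi).2,
    ← Finset.sum_add_distrib]
  refine Finset.even_sum _ fun v _ => ?_
  rcases D.degree t v with h | h <;> rw [h] <;> decide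

lemma even_below {t : ℤ} {p : Plane} (h : p.2 = t) :
    Even ((D.below t p).card + (D.below (t - 1) p).card) := by
  have := D.even_level t p.1
  convert this using 4
  · rw [below, h]
    simp only [X_bot]
  · rw [below, h]
    have : (t : ℝ) = ((t - 1 : ℤ) : ℝ) + 1 := by push_cast; ring
    simp only [this, X_top]

/-- Far to the right `even_level` counts whole layers, so parity passes from a layer to the one
below it; the layers above the drawing are empty. -/
lemma even_card_strands (t : ℤ) : Even (D.strands t).card := by
  obtain ⟨R, hR⟩ := D.exists_bound
  have step (t : ℤ) : Even ((D.strands t).card + (D.strands (t - 1)).card) := by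
    have := D.even_level t R
    rwa [Finset.filter_true_of_mem, Finset.filter_true_of_mem] at this
    · exact fun i hi => by exact_mod_cast (hR _ i hi).2
    · exact fun i hi => by exact_mod_cast (hR _ i hi).1
  have empty (t : ℤ) (ht : D.hi ≤ t) : D.strands t = ∅ :=
    Finset.eq_empty_of_forall_notMem fun i hi => by have := D.range_of_mem t i hi; omega
  have main (n : ℕ) : Even (D.strands (D.hi - n)).card := by
    induction n with
    | zero => simp [empty]
    | succ n ih =>
      have := (Nat.even_add.1 (step (D.hi - n))).1 ih
      rwa [show D.hi - (n : ℤ) - 1 = D.hi - ((n + 1 : ℕ) : ℤ) by push_cast; ring] at this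
  rcases le_total D.hi t with h | h
  · simp [empty t h]
  · have := main (D.hi - t).toNat
    rwa [show D.hi - ((D.hi - t).toNat : ℤ) = t by omega] at this

lemma eventually_below_eq {p : Plane} (hp : p ∉ D.curve) {t : ℤ} (h1 : t ≤ p.2)
    (h2 : p.2 ≤ t + 1) : ∀ᶠ q in 𝓝 p, D.below t q = D.below t p := by
  have h (i) (hi : i ∈ D.strands t) :
      ∀ᶠ q : Plane in 𝓝 p, (D.X t i q.2 < q.1 ↔ D.X t i p.2 < p.1) := by
    have c : Continuous fun q : Plane => D.X t i q.2 := (continuous_X t i).comp continuous_snd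
    rcases lt_trichotomy (D.X t i p.2) p.1 with h | h | h
    · filter_upwards [c.continuousAt.eventually_lt continuous_fst.continuousAt h] with q hq
      simp [hq, h]
    · exact absurd (mem_curve.2 ⟨t, i, hi, h1, h2, h.symm⟩) hp
    · filter_upwards [continuous_fst.continuousAt.eventually_lt c.continuousAt h] with q hq
      exact iff_of_false (lt_asymm hq) (lt_asymm h)
  filter_upwards [(Finset.eventually_all _).2 h] with q hq
  exact Finset.filter_congr hq

/-- The floor assigns the upper edge of a layer to the next layer; parity does not notice this.
Therefore a closed layer may be used in place of the floor. -/
lemma odd_below_iff {p : Plane} {t : ℤ} (h1 : t ≤ p.2) (h2 : p.2 ≤ t + 1) :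
    Odd (D.below ⌊p.2⌋ p).card ↔ Odd (D.below t p).card := by
  rcases h2.eq_or_lt with h | h
  · have h' : p.2 = ((t + 1 : ℤ) : ℝ) := by rw [h]; push_cast; ring
    have : ⌊p.2⌋ = t + 1 := by rw [h', Int.floor_intCast]
    rw [this]
    have := D.even_below h'
    rw [add_sub_cancel_right, Nat.even_add] at this
    rw [← Nat.not_even_iff_odd, ← Nat.not_even_iff_odd, this]
  · rw [Int.floor_eq_iff.2 ⟨h1, h⟩]

lemma eventually_odd_iff {p : Plane} (hp : p ∉ D.curve) :
    ∀ᶠ q in 𝓝 p, (Odd (D.below ⌊q.2⌋ q).card ↔ Odd (D.below ⌊p.2⌋ p).card) := by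
  have up := Int.lt_floor_add_one p.2
  have lo := Int.floor_le p.2
  -- A point of integer height has neighbours in two layers, and the counts in both must be
  -- compared.
  rcases lo.eq_or_lt with h | h
  · have e1 := eventually_below_eq hp (t := ⌊p.2⌋) lo up.le
    have h1 : ((⌊p.2⌋ - 1 : ℤ) : ℝ) ≤ p.2 := by push_cast; linarith
    have h2 : p.2 ≤ ((⌊p.2⌋ - 1 : ℤ) : ℝ) + 1 := by push_cast; linarith
    have e2 := eventually_below_eq hp h1 h2
    have e3 : ∀ᶠ q : Plane in 𝓝 p, q.2 < ⌊p.2⌋ + 1 :=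
      continuous_snd.continuousAt.eventually_lt continuousAt_const up
    have e4 : ∀ᶠ q : Plane in 𝓝 p, (⌊p.2⌋ : ℝ) - 1 < q.2 :=
      continuousAt_const.eventually_lt continuous_snd.continuousAt (by linarith)
    filter_upwards [e1, e2, e3, e4] with q e1 e2 e3 e4
    rcases le_total (⌊p.2⌋ : ℝ) q.2 with h3 | h3
    · rw [odd_below_iff h3 e3.le, e1]
    · rw [odd_below_iff (t := ⌊p.2⌋ - 1) (by push_cast; linarith) (by push_cast; linarith), e2,
        odd_below_iff h1 h2]
  · filter_upwards [eventually_below_eq hp lo up.le,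
      continuous_snd.continuousAt.eventually_lt continuousAt_const up,
      continuousAt_const.eventually_lt continuous_snd.continuousAt h] with q e1 e2 e3
    rw [odd_below_iff e3.le e2.le, e1]

/-! ### Topology of the region: frontier, regularity, boundedness -/

lemma isOpen_region : IsOpen D.region := by
  rw [isOpen_iff_mem_nhds]
  intro p hp
  filter_upwards [D.isClosed_curve.isOpen_compl.mem_nhds hp.1, eventually_odd_iff hp.1] with q h1 h2
  exact ⟨h1, h2.2 hp.2⟩

lemma isOpen_outside : IsOpen D.outside := by
  rw [isOpen_iff_mem_nhds]
  intro p hp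
  filter_upwards [D.isClosed_curve.isOpen_compl.mem_nhds hp.1, eventually_odd_iff hp.1] with q h1 h2
  exact ⟨h1, fun h => hp.2 (h2.1 h)⟩

lemma mem_curve_of_lt {p : Plane} {t : ℤ} (h1 : t < p.2) (h2 : p.2 < t + 1) (hp : p ∈ D.curve) :
    ∃ i ∈ D.strands t, p.1 = D.X t i p.2 := by
  obtain ⟨s, i, hi, h3, h4, h5⟩ := mem_curve.1 hp
  have a1 : (s : ℝ) < t + 1 := by linarith
  have a2 : (t : ℝ) < s + 1 := by linarith
  have a3 : s < t + 1 := by exact_mod_cast a1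
  have a4 : t < s + 1 := by exact_mod_cast a2
  obtain rfl : s = t := by omega
  exact ⟨i, hi, h5⟩

/-- On a horizontal line just left of strand `i` the strands counted are those with smaller index;
just right of it `i` is added. The two sides therefore have opposite parity, whichever it is. -/
lemma mem_closure_of_lt {t : ℤ} {i : ℕ} (hi : i ∈ D.strands t) {y : ℝ} (h1 : t < y)
    (h2 : y < t + 1) :
    (D.X t i y, y) ∈ closure D.region ∩ closure D.outside := by
  set x := D.X t i y with hx
  have hfloor : ⌊y⌋ = t := Int.floor_eq_iff.2 ⟨h1.le, h2⟩
  have off {x' : ℝ} (h : ∀ j ∈ D.strands t, D.X t j y ≠ x') : ((x', y) : Plane) ∉ D.curve := by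
    intro hc
    obtain ⟨j, hj, h3⟩ := mem_curve_of_lt (p := (x', y)) h1 h2 hc
    exact h j hj h3.symm
  have tl (l : Filter ℝ) (hl : l ≤ 𝓝 x) : Tendsto (fun x' : ℝ => ((x', y) : Plane)) l (𝓝 (x, y)) :=
    ((by fun_prop : Continuous fun x' : ℝ => ((x', y) : Plane)).tendsto x).mono_left hl
  have left : ∀ᶠ x' in 𝓝[<] x, ((x', y) : Plane) ∉ D.curve ∧
      D.below ⌊y⌋ (x', y) = (D.strands t).filter (· < i) := by
    have : ∀ j ∈ D.strands t, ∀ᶠ x' in 𝓝[<] x, (D.X t j y < x' ↔ j < i) ∧ D.X t j y ≠ x' := by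
      intro j hj
      rcases lt_or_ge j i with h | h
      · filter_upwards [mem_nhdsWithin_of_mem_nhds (Ioi_mem_nhds (X_lt hj hi h h1 h2))] with x' h'
        exact ⟨by simpa [h] using h', (ne_of_lt h')⟩
      · have : x ≤ D.X t j y := by
          rcases h.eq_or_lt with rfl | h
          · exact le_rfl
          · exact (X_lt hi hj h h1 h2).le
        filter_upwards [self_mem_nhdsWithin] with x' h'
        have h' : x' < x := h'
        exact ⟨by constructor <;> intro <;> [linarith; omega], by intro h''; linarith⟩
    filter_upwards [(Finset.eventually_all _).2 this] with x' h'
    refine ⟨off fun j hj => (h' j hj).2, ?_⟩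
    rw [hfloor]
    exact Finset.filter_congr fun j hj => (h' j hj).1
  have right : ∀ᶠ x' in 𝓝[>] x, ((x', y) : Plane) ∉ D.curve ∧
      D.below ⌊y⌋ (x', y) = insert i ((D.strands t).filter (· < i)) := by
    have : ∀ j ∈ D.strands t, ∀ᶠ x' in 𝓝[>] x, (D.X t j y < x' ↔ j ≤ i) ∧ D.X t j y ≠ x' := by
      intro j hj
      rcases lt_or_ge i j with h | h
      · filter_upwards [mem_nhdsWithin_of_mem_nhds (Iio_mem_nhds (X_lt hi hj h h1 h2))] with x' h'
        have h' : x' < _ := h'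
        exact ⟨by constructor <;> intro <;> [linarith; omega], by intro h''; linarith⟩
      · have : D.X t j y ≤ x := by
          rcases h.eq_or_lt with rfl | h
          · exact le_rfl
          · exact (X_lt hj hi h h1 h2).le
        filter_upwards [self_mem_nhdsWithin] with x' h'
        have h' : x < x' := h'
        exact ⟨by constructor <;> intro <;> [omega; linarith], by intro h''; linarith⟩
    filter_upwards [(Finset.eventually_all _).2 this] with x' h'
    refine ⟨off fun j hj => (h' j hj).2, ?_⟩
    rw [hfloor]
    refine (Finset.filter_congr fun j hj => (h' j hj).1).trans ?_
    ext j
    simp only [Finset.mem_filter, Finset.mem_insert]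
    constructor
    · rintro ⟨h3, h4⟩
      rcases h4.eq_or_lt with h4 | h4
      · exact Or.inl h4
      · exact Or.inr ⟨h3, h4⟩
    · rintro (rfl | h)
      · exact ⟨hi, le_rfl⟩
      · exact ⟨h.1, h.2.le⟩
  have card : (insert i ((D.strands t).filter (· < i))).card =
      ((D.strands t).filter (· < i)).card + 1 := Finset.card_insert_of_notMem (by simp)
  by_cases hodd : Odd ((D.strands t).filter (· < i)).card
  · refine ⟨mem_closure_of_tendsto (tl _ nhdsWithin_le_nhds) (left.mono fun x' h => ⟨h.1, ?_⟩),
      mem_closure_of_tendsto (tl _ nhdsWithin_le_nhds) (right.mono fun x' h => ⟨h.1, ?_⟩)⟩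
    · exact h.2 ▸ hodd
    · change ¬ Odd (D.below ⌊y⌋ _).card
      rw [h.2, card, Nat.odd_add_one]
      simpa using hodd
  · refine ⟨mem_closure_of_tendsto (tl _ nhdsWithin_le_nhds) (right.mono fun x' h => ⟨h.1, ?_⟩),
      mem_closure_of_tendsto (tl _ nhdsWithin_le_nhds) (left.mono fun x' h => ⟨h.1, ?_⟩)⟩
    · change Odd (D.below ⌊y⌋ _).card
      rw [h.2, card, Nat.odd_add_one]
      exact hodd
    · exact h.2 ▸ hodd

/-- Vertices are limits of inner points of a strand, so the local picture at a vertex never has to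
be analysed. -/
lemma curve_subset_closure : D.curve ⊆ closure D.region ∩ closure D.outside := by
  intro p hp
  obtain ⟨t, i, hi, h1, h2, h3⟩ := mem_curve.1 hp
  have hc : Continuous fun y : ℝ => ((D.X t i y, y) : Plane) :=
    (continuous_X t i).prodMk continuous_id
  have hp' : p = (D.X t i p.2, p.2) := Prod.ext h3 rfl
  have hy : p.2 ∈ closure (Ioo (t : ℝ) (t + 1)) := by
    rw [closure_Ioo (by linarith [lt_add_one (t : ℝ)] : (t : ℝ) ≠ t + 1)]
    exact ⟨h1, h2⟩
  have := map_mem_closure hc hy (t := closure D.region ∩ closure D.outside)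
    fun y hy => mem_closure_of_lt hi hy.1 hy.2
  rwa [(isClosed_closure.inter isClosed_closure).closure_eq, ← hp'] at this

/-- Region, curve and `outside` partition the plane, and `outside` is open. -/
lemma closure_region : closure D.region = D.region ∪ D.curve := by
  apply Subset.antisymm
  · have : IsClosed (D.outsideᶜ) := D.isOpen_outside.isClosed_compl
    refine (closure_minimal (t := D.outsideᶜ) ?_ this).trans ?_
    · exact fun p hp h => h.2 hp.2
    · intro p hp
      by_cases hc : p ∈ D.curve
      · exact Or.inr hc
      · by_cases ho : Odd (D.below ⌊p.2⌋ p).card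
        · exact Or.inl ⟨hc, ho⟩
        · exact absurd ⟨hc, ho⟩ hp
  · exact union_subset subset_closure fun p hp => (curve_subset_closure hp).1

lemma frontier_region : frontier D.region = D.curve := by
  rw [D.isOpen_region.frontier_eq, closure_region, union_sdiff_left]
  exact sdiff_eq_left.2 (Set.disjoint_left.2 fun p hp h => h.1 hp)

lemma interior_closure_region : interior (closure D.region) = D.region := by
  apply Subset.antisymm
  · intro p hp
    rw [closure_region] at hp
    rcases interior_subset hp with h | h
    · exact h
    · obtain ⟨q, h1, h2⟩ := mem_closure_iff.1 (curve_subset_closure h).2 _ isOpen_interior hp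
      rcases interior_subset h1 with h | h
      · exact absurd h.2 h2.2
      · exact absurd h h2.1
  · exact interior_maximal subset_closure D.isOpen_region

lemma exists_strand_of_mem_region {p : Plane} (hp : p ∈ D.region) :
    ∃ i, i ∈ D.strands ⌊p.2⌋ := by
  obtain ⟨i, hi⟩ := Finset.card_pos.1 hp.2.pos
  exact ⟨i, (Finset.mem_filter.1 hi).1⟩

lemma height_of_mem_region {p : Plane} (hp : p ∈ D.region) :
    (D.lo : ℝ) ≤ p.2 ∧ p.2 ≤ D.hi := by
  obtain ⟨i, hi⟩ := exists_strand_of_mem_region hp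
  have := D.range_of_mem _ i hi
  have h1 : (D.lo : ℝ) ≤ ⌊p.2⌋ := by exact_mod_cast this.1
  have h2 : (⌊p.2⌋ : ℝ) + 1 ≤ D.hi := by exact_mod_cast this.2
  exact ⟨h1.trans (Int.floor_le _), (Int.lt_floor_add_one _).le.trans h2⟩

lemma isBounded_region : Bornology.IsBounded D.region := by
  obtain ⟨R, hR⟩ := D.exists_bound
  refine ((Metric.isBounded_Icc (0 : ℝ) R).prod (Metric.isBounded_Icc (D.lo : ℝ) D.hi)).subset ?_
  intro p hp
  refine ⟨?_, height_of_mem_region hp⟩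
  have lo := Int.floor_le p.2
  have up := (Int.lt_floor_add_one p.2).le
  constructor
  · obtain ⟨i, hi⟩ := Finset.card_pos.1 hp.2.pos
    obtain ⟨h1, h2⟩ := Finset.mem_filter.1 hi
    exact (X_mem_Icc hR h1 lo up).1.trans h2.le
  -- To the right of all strands the whole layer is counted, and its cardinality is even.
  · by_contra! h
    refine Nat.not_even_iff_odd.2 hp.2 ?_
    rw [below, Finset.filter_true_of_mem]
    · exact D.even_card_strands _
    · exact fun i hi => (X_mem_Icc hR hi lo up).2.trans h

lemma curve_nonempty : D.curve.Nonempty := by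
  obtain ⟨t, i, hi⟩ := D.exists_mem
  exact ⟨((D.bot t i : ℝ), (t : ℝ)), mem_curve.2 ⟨t, i, hi, le_rfl, by simp, by simp⟩⟩

lemma region_nonempty : D.region.Nonempty := by
  obtain ⟨p, hp⟩ := D.curve_nonempty
  exact closure_nonempty_iff.1 ⟨p, (curve_subset_closure hp).1⟩

/-! ### The curve is polygonal -/

lemma seg_eq_segment (x : ℤ × ℕ) : D.seg x = segment ℝ (D.edge x).1 (D.edge x).2 := by
  ext p
  rw [segment_eq_image]
  simp only [seg, edge, Set.mem_ofPred_eq, Set.mem_image]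
  constructor
  · rintro ⟨h1, h2, h3⟩
    refine ⟨p.2 - x.1, ⟨by linarith, by linarith⟩, Prod.ext ?_ ?_⟩
    · simp only [Prod.smul_mk, smul_eq_mul, Prod.mk_add_mk]
      rw [h3, X]; ring
    · simp only [Prod.smul_mk, smul_eq_mul, Prod.mk_add_mk]
      ring
  · rintro ⟨s, ⟨h1, h2⟩, rfl⟩
    simp only [Prod.smul_mk, smul_eq_mul, Prod.mk_add_mk, X]
    refine ⟨by linarith, by linarith, by ring⟩

/-- By `mono` two strands of a layer differ in at least one end; hence counting segments at a vertex
is the same as counting strands. -/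
lemma injOn_edge : InjOn D.edge D.index := by
  rintro ⟨t, i⟩ hi ⟨s, j⟩ hj h
  simp only [edge, Prod.mk.injEq, Nat.cast_inj, Int.cast_inj] at h
  obtain ⟨⟨h1, rfl⟩, h2, -⟩ := h
  rcases lt_trichotomy i j with h | h | h
  · have := D.mono t i hi j hj h; omega
  · rw [h]
  · have := D.mono t j hj i hi h; omega

lemma eq_ends_of_mem_seg {x y : ℤ × ℕ} (hx : x ∈ D.index) (hy : y ∈ D.index) (hxy : x ≠ y)
    {p : Plane} (h1 : p ∈ D.seg x) (h2 : p ∈ D.seg y) :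
    (p = (D.edge x).1 ∨ p = (D.edge x).2) := by
  obtain ⟨t, i⟩ := x
  obtain ⟨s, j⟩ := y
  obtain ⟨a1, a2, a3⟩ := h1
  obtain ⟨b1, b2, b3⟩ := h2
  dsimp only at a1 a2 a3 b1 b2 b3
  rcases a1.eq_or_lt with a1 | a1
  · left
    refine Prod.ext ?_ a1.symm
    rw [a3, ← a1]; simp [edge]
  rcases a2.eq_or_lt with a2 | a2
  · right
    refine Prod.ext ?_ a2
    rw [a3, a2]; simp [edge]
  have c1 : (s : ℝ) < t + 1 := by linarith
  have c2 : (t : ℝ) < s + 1 := by linarith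
  have c3 : s < t + 1 := by exact_mod_cast c1
  have c4 : t < s + 1 := by exact_mod_cast c2
  obtain rfl : s = t := by omega
  exact absurd (congrArg (Prod.mk s) (eq_of_X_eq hx hy a1 a2 (a3.symm.trans b3))) hxy

lemma isPolygonalCurve_curve : IsPolygonalCurve D.curve := by
  refine ⟨D.edge '' D.index, D.finite_index.image _, ?_, ?_, ?_, ?_⟩
  · simp only [curve, biUnion_image, seg_eq_segment]
  · rintro _ ⟨x, -, rfl⟩ h
    have := congrArg Prod.snd h
    simp [edge] at this
  · rintro _ ⟨x, hx, rfl⟩ _ ⟨y, hy, rfl⟩ hne p ⟨h1, h2⟩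
    rw [← seg_eq_segment] at h1 h2
    have hxy : x ≠ y := fun h => hne (by rw [h])
    exact ⟨eq_ends_of_mem_seg hx hy hxy h1 h2, eq_ends_of_mem_seg hy hx hxy.symm h2 h1⟩
  · intro e he v hv
    obtain ⟨n, t, rfl⟩ : ∃ (n : ℕ) (t : ℤ), v = ((n : ℝ), (t : ℝ)) := by
      obtain ⟨x, -, rfl⟩ := he
      rcases hv with rfl | rfl
      · exact ⟨_, _, rfl⟩
      · exact ⟨D.top x.1 x.2, x.1 + 1, by simp [edge]⟩
    set A : Finset ℕ := (D.strands t).filter (D.bot t · = n) with hA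
    set B : Finset ℕ := (D.strands (t - 1)).filter (D.top (t - 1) · = n) with hB
    have hset : {f | f ∈ D.edge '' D.index ∧ ((((n : ℝ), (t : ℝ)) : Plane) = f.1 ∨
        (((n : ℝ), (t : ℝ)) : Plane) = f.2)} =
        D.edge '' ((A.image (Prod.mk t) ∪ B.image (Prod.mk (t - 1)) : Finset (ℤ × ℕ)) :
          Set (ℤ × ℕ)) := by
      ext f
      constructor
      · rintro ⟨⟨⟨s, i⟩, hi, rfl⟩, h | h⟩
        all_goals have hi : i ∈ D.strands s := hi
        · simp only [edge, Prod.mk.injEq, Nat.cast_inj, Int.cast_inj] at h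
          obtain ⟨h, rfl⟩ := h
          exact ⟨(t, i), by simp [hA, hi, h.symm], rfl⟩
        · simp only [edge, Prod.mk.injEq, Nat.cast_inj] at h
          obtain ⟨h, h'⟩ := h
          obtain rfl : s = t - 1 := by
            have : t = s + 1 := by exact_mod_cast h'
            omega
          exact ⟨(t - 1, i), by simp [hB, hi, h.symm], rfl⟩
      · rintro ⟨x, hx, rfl⟩
        simp only [Finset.coe_union, Finset.coe_image, mem_union, mem_image, Finset.mem_coe, hA, hB,
          Finset.mem_filter] at hx
        rcases hx with ⟨i, ⟨hi, h⟩, rfl⟩ | ⟨i, ⟨hi, h⟩, rfl⟩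
        · exact ⟨⟨_, hi, rfl⟩, Or.inl (by simp [edge, h])⟩
        · exact ⟨⟨_, hi, rfl⟩, Or.inr (by simp [edge, h])⟩
    have hsub : ((A.image (Prod.mk t) ∪ B.image (Prod.mk (t - 1)) : Finset (ℤ × ℕ)) :
          Set (ℤ × ℕ)) ⊆ D.index := by
      intro x hx
      simp only [Finset.coe_union, Finset.coe_image, mem_union, mem_image, Finset.mem_coe, hA, hB,
          Finset.mem_filter] at hx
      rcases hx with ⟨i, ⟨hi, h⟩, rfl⟩ | ⟨i, ⟨hi, h⟩, rfl⟩ <;> exact hi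
    have hcard : (A.image (Prod.mk t) ∪ B.image (Prod.mk (t - 1)) : Finset (ℤ × ℕ)).card =
        A.card + B.card := by
      rw [Finset.card_union_of_disjoint, Finset.card_image_of_injective _ (Prod.mk_right_injective _),
        Finset.card_image_of_injective _ (Prod.mk_right_injective _)]
      rw [Finset.disjoint_left]
      intro x h1 h2
      simp only [Finset.mem_image] at h1 h2
      obtain ⟨i, -, rfl⟩ := h1
      obtain ⟨j, -, h⟩ := h2
      have := congrArg Prod.fst h
      simp at this
    have hpos : {f | f ∈ D.edge '' D.index ∧ ((((n : ℝ), (t : ℝ)) : Plane) = f.1 ∨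
        (((n : ℝ), (t : ℝ)) : Plane) = f.2)}.ncard ≠ 0 := by
      have hfin : {f | f ∈ D.edge '' D.index ∧ ((((n : ℝ), (t : ℝ)) : Plane) = f.1 ∨
          (((n : ℝ), (t : ℝ)) : Plane) = f.2)}.Finite :=
        (D.finite_index.image D.edge).subset fun f hf => hf.1
      exact ((Set.ncard_pos hfin).2 ⟨e, he, hv⟩).ne'
    rw [hset, (injOn_edge.mono hsub).ncard_image, Set.ncard_coe_finset, hcard] at hpos ⊢
    -- The vertex is an end of the segment `e`, which excludes degree 0.
    exact (D.degree t n).resolve_left hpos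

lemma isPlaneDomain_region : IsPlaneDomain D.region where
  nonempty := region_nonempty
  isOpen := isOpen_region
  isBounded := isBounded_region
  regular := interior_closure_region
  boundary := by rw [frontier_region]; exact isPolygonalCurve_curve

/-! ### Noncritical heights -/

/-- Near each of its points the curve consists of the strands through this point. -/
lemma eventually_mem_seg (D : Drawing) (p : Plane) :
    ∀ᶠ q in 𝓝 p, q ∈ D.curve → ∃ x ∈ D.index, p ∈ D.seg x ∧ q ∈ D.seg x := by
  have h : ∀ x ∈ D.index, ∀ᶠ q in 𝓝 p, q ∈ D.seg x → p ∈ D.seg x := by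
    intro x _
    by_cases hp : p ∈ D.seg x
    · exact Eventually.of_forall fun _ _ => hp
    · filter_upwards [(isClosed_seg x).isOpen_compl.mem_nhds hp] with q hq h
      exact absurd h hq
  filter_upwards [(D.finite_index.eventually_all).2 h] with q hq hqc
  obtain ⟨x, hx, hqx⟩ := mem_iUnion₂.1 hqc
  exact ⟨x, hx, hq x hx hqx, hqx⟩

end Drawing

/-- A height is not critical if the height function is locally injective on the curve at the points
of this height. -/
lemma not_isCritical_of_injOn {K : Set Plane} {c : ℝ}
    (h : ∀ p ∈ K, p.2 = c → ∃ U ∈ 𝓝 p, InjOn Prod.snd (K ∩ U)) : ¬ IsCritical K c := by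
  rintro ⟨A, hAK, p, q, ⟨γ, hc, hinj, rfl, rfl, rfl⟩, hp, hq, ⟨_, ⟨s, hs, rfl⟩, hsc⟩, hext⟩
  have hs0 : 0 < s := lt_of_le_of_ne hs.1 (by rintro rfl; exact hp hsc)
  have hs1 : s < 1 := lt_of_le_of_ne hs.2 (by rintro rfl; exact hq hsc)
  obtain ⟨U, hU, hUinj⟩ := h _ (hAK ⟨s, hs, rfl⟩) hsc
  have hca : ContinuousAt γ s := hc.continuousAt (Icc_mem_nhds hs0 hs1)
  obtain ⟨ε, hε, hball⟩ := Metric.mem_nhds_iff.1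
    (Filter.inter_mem (hca.preimage_mem_nhds hU) (Icc_mem_nhds hs0 hs1))
  have hsub : Icc (s - ε / 2) (s + ε / 2) ⊆ γ ⁻¹' U ∩ Icc 0 1 := by
    intro r hr
    apply hball
    rw [Metric.mem_ball, Real.dist_eq, abs_lt]
    constructor <;> linarith [hr.1, hr.2]
  have hcont : ContinuousOn (fun r => (γ r).2) (Icc (s - ε / 2) (s + ε / 2)) :=
    continuous_snd.comp_continuousOn (hc.mono fun r hr => (hsub hr).2)
  have hi : InjOn (fun r => (γ r).2) (Icc (s - ε / 2) (s + ε / 2)) := by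
    intro r hr r' hr' e
    exact hinj (hsub hr).2 (hsub hr').2
      (hUinj ⟨hAK ⟨r, (hsub hr).2, rfl⟩, (hsub hr).1⟩ ⟨hAK ⟨r', (hsub hr').2, rfl⟩, (hsub hr').1⟩ e)
  have m0 : s - ε / 2 ∈ Icc (s - ε / 2) (s + ε / 2) := ⟨by linarith, by linarith⟩
  have m1 : s ∈ Icc (s - ε / 2) (s + ε / 2) := ⟨by linarith, by linarith⟩
  have m2 : s + ε / 2 ∈ Icc (s - ε / 2) (s + ε / 2) := ⟨by linarith, by linarith⟩
  have l1 : s - ε / 2 < s := by linarith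
  have l2 : s < s + ε / 2 := by linarith
  -- A continuous injective height is strictly monotone near `s`, so it takes values on both sides
  -- of `c`, against extremality.
  rcases hcont.strictMonoOn_of_injOn_Icc' (by linarith) hi with hm | hm
  · have e1 := hm m0 m1 l1
    have e2 := hm m1 m2 l2
    rcases hext with he | he
    · have := he _ ⟨_, (hsub m0).2, rfl⟩
      dsimp only at e1; linarith
    · have := he _ ⟨_, (hsub m2).2, rfl⟩
      dsimp only at e2; linarith
  · have e1 := hm m0 m1 l1
    have e2 := hm m1 m2 l2
    rcases hext with he | he
    · have := he _ ⟨_, (hsub m2).2, rfl⟩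
      dsimp only at e2; linarith
    · have := he _ ⟨_, (hsub m0).2, rfl⟩
      dsimp only at e1; linarith

namespace Drawing

variable {D : Drawing}

/-- If at most one strand of each layer passes through a point, then near it the curve is at most
one strand going up and one going down, and height is injective there. -/
lemma not_isCritical_of_forall_seg {c : ℝ}
    (h : ∀ p : Plane, p.2 = c → ∀ x ∈ D.index, ∀ y ∈ D.index, p ∈ D.seg x → p ∈ D.seg y →
      x.1 = y.1 → x = y) : ¬ IsCritical D.curve c := by
  refine not_isCritical_of_injOn fun p _ hpc =>
    ⟨_, D.eventually_mem_seg p, ?_⟩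
  rintro q ⟨hq, hq'⟩ r ⟨hr, hr'⟩ e
  obtain ⟨⟨t, i⟩, hx, hpx, hqx⟩ := hq' hq
  obtain ⟨⟨s, j⟩, hy, hpy, hry⟩ := hr' hr
  have main : ∀ {t s : ℤ} {i j : ℕ} {q r : Plane}, (t, i) ∈ D.index → (s, j) ∈ D.index →
      p ∈ D.seg (t, i) → p ∈ D.seg (s, j) → q ∈ D.seg (t, i) → r ∈ D.seg (s, j) → q.2 = r.2 →
      t ≤ s → q = r := by
    intro t s i j q r hx hy hpx hpy hqx hry e hts
    rcases hts.eq_or_lt with rfl | hts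
    · have := h p hpc _ hx _ hy hpx hpy rfl
      rw [Prod.mk.injEq] at this
      obtain ⟨-, rfl⟩ := this
      exact Prod.ext (by rw [hqx.2.2, hry.2.2, e]) e
    -- Strands through `p` in different layers lie on opposite sides of its level, so points of
    -- equal height on them both lie on that level and coincide with `p`.
    · have h1 : (t : ℝ) + 1 ≤ s := by exact_mod_cast hts
      have h2 := hqx.2.1
      have h3 := hry.1
      have h4 := hpx.2.1
      have h5 := hpy.1
      dsimp only at h2 h3 h4 h5
      have e1 : q.2 = p.2 := by linarith
      have e2 : r.2 = p.2 := by linarith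
      refine Prod.ext ?_ e
      rw [hqx.2.2, hry.2.2, e1, e2, ← hpx.2.2, ← hpy.2.2]
  rcases le_total t s with hts | hts
  · exact main hx hy hpx hpy hqx hry e hts
  · exact (main hy hx hpy hpx hry hqx e.symm hts).symm

/-- Inside a layer there are no critical heights. -/
lemma not_isCritical_of_lt {t : ℤ} {c : ℝ} (h1 : t < c) (h2 : c < t + 1) :
    ¬ IsCritical D.curve c := by
  refine not_isCritical_of_forall_seg ?_
  rintro p rfl ⟨s, i⟩ hx ⟨s', j⟩ hy hpx hpy hs
  obtain rfl : s = s' := hs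
  have layer : s = t := by
    have a1 : (s : ℝ) < t + 1 := lt_of_le_of_lt hpx.1 h2
    have a2 : (t : ℝ) < s + 1 := lt_of_lt_of_le h1 hpx.2.1
    have a3 : s < t + 1 := by exact_mod_cast a1
    have a4 : t < s + 1 := by exact_mod_cast a2
    omega
  subst layer
  exact congrArg (Prod.mk s) (eq_of_X_eq hx hy h1 h2 (hpx.2.2.symm.trans hpy.2.2))

/-- A level at which the ends of the strands of each adjacent layer are distinct is not critical. -/
lemma not_isCritical_level {t : ℤ} (hb : InjOn (D.bot t) (D.strands t))
    (ht : InjOn (D.top (t - 1)) (D.strands (t - 1))) : ¬ IsCritical D.curve t := by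
  refine not_isCritical_of_forall_seg ?_
  rintro p hpc ⟨s, i⟩ hx ⟨s', j⟩ hy hpx hpy hs
  obtain rfl : s = s' := hs
  have e := hpx.2.2.symm.trans hpy.2.2
  have c1 := hpx.1
  have c2 := hpx.2.1
  dsimp only at e c1 c2
  rw [hpc] at e c1 c2
  have c3 : s ≤ t := by exact_mod_cast c1
  have c4 : t ≤ s + 1 := by exact_mod_cast c2
  rcases (by omega : s = t ∨ s = t - 1) with rfl | rfl
  · rw [X_bot, X_bot, Nat.cast_inj] at e
    exact congrArg (Prod.mk s) (hb hx hy e)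
  · rw [show (t : ℝ) = ((t - 1 : ℤ) : ℝ) + 1 by push_cast; ring, X_top, X_top, Nat.cast_inj] at e
    exact congrArg (Prod.mk (t - 1)) (ht hx hy e)

end Drawing
/-! ### Arcs -/

namespace IsArc

variable {A B : Set Plane} {p q r o : Plane}

lemma left_mem (h : IsArc A p q) : p ∈ A := by
  obtain ⟨γ, -, -, rfl, rfl, -⟩ := h
  exact ⟨0, by simp, rfl⟩

lemma right_mem (h : IsArc A p q) : q ∈ A := by
  obtain ⟨γ, -, -, rfl, -, rfl⟩ := h
  exact ⟨1, by simp, rfl⟩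

lemma symm (h : IsArc A p q) : IsArc A q p := by
  obtain ⟨γ, hc, hi, rfl, rfl, rfl⟩ := h
  have hm : MapsTo (fun s : ℝ => 1 - s) (Icc 0 1) (Icc 0 1) :=
    fun s hs => ⟨by linarith [hs.2], by linarith [hs.1]⟩
  refine ⟨fun s => γ (1 - s), hc.comp (by fun_prop) hm, ?_, ?_, by simp, by simp⟩
  · intro s hs s' hs' e
    have := hi (hm hs) (hm hs') e
    linarith
  · ext x
    constructor
    · rintro ⟨s, hs, rfl⟩
      exact ⟨1 - s, hm hs, rfl⟩
    · rintro ⟨s, hs, rfl⟩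
      exact ⟨1 - s, hm hs, by simp⟩

lemma isPreconnected (h : IsArc A p q) : IsPreconnected A := by
  obtain ⟨γ, hc, -, rfl, -, -⟩ := h
  exact isPreconnected_Icc.image γ hc

/-- Two arcs with only a common end form an arc. -/
lemma union (hA : IsArc A p q) (hB : IsArc B q r) (hAB : A ∩ B ⊆ {q}) : IsArc (A ∪ B) p r := by
  obtain ⟨α, hαc, hαi, rfl, rfl, rfl⟩ := hA
  obtain ⟨β, hβc, hβi, rfl, hβ, rfl⟩ := hB
  set γ : ℝ → Plane := fun s => if s ≤ 1 / 2 then α (2 * s) else β (2 * s - 1) with hγ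
  have h1 : EqOn γ (fun s => α (2 * s)) (Icc 0 (1 / 2)) := fun s hs => if_pos hs.2
  have h2 : EqOn γ (fun s => β (2 * s - 1)) (Icc (1 / 2) 1) := by
    intro s hs
    rcases hs.1.eq_or_lt with rfl | h
    · simp [hγ, hβ]
    · exact if_neg (not_le.2 h)
  have m1 : MapsTo (fun s : ℝ => 2 * s) (Icc 0 (1 / 2)) (Icc 0 1) :=
    fun s hs => ⟨by linarith [hs.1], by linarith [hs.2]⟩
  have m2 : MapsTo (fun s : ℝ => 2 * s - 1) (Icc (1 / 2) 1) (Icc 0 1) :=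
    fun s hs => ⟨by linarith [hs.1], by linarith [hs.2]⟩
  have hu : Icc (0 : ℝ) (1 / 2) ∪ Icc (1 / 2) 1 = Icc 0 1 :=
    Icc_union_Icc_eq_Icc (by norm_num) (by norm_num)
  have cross : ∀ s ∈ Icc (0 : ℝ) (1 / 2), ∀ s' ∈ Icc (1 / 2 : ℝ) 1, γ s = γ s' → s = s' := by
    intro s hs s' hs' e
    rw [h1 hs, h2 hs'] at e
    have e1 : α (2 * s) = α 1 := hAB ⟨⟨_, m1 hs, rfl⟩, ⟨_, m2 hs', e.symm⟩⟩
    have e2 : β (2 * s' - 1) = β 0 := by rw [hβ, ← e1]; exact e.symm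
    have := hαi (m1 hs) (by simp) e1
    have := hβi (m2 hs') (by simp) e2
    linarith
  refine ⟨γ, ?_, ?_, ?_, ?_, ?_⟩
  · rw [← hu]
    exact ((hαc.comp (by fun_prop) m1).congr h1).union_of_isClosed
      ((hβc.comp (by fun_prop) m2).congr h2) isClosed_Icc isClosed_Icc
  · rw [← hu]
    rintro s (hs | hs) s' (hs' | hs') e
    · have := hαi (m1 hs) (m1 hs') (by rwa [h1 hs, h1 hs'] at e)
      linarith
    · exact cross s hs s' hs' e
    · exact (cross s' hs' s hs e.symm).symm
    · have := hβi (m2 hs) (m2 hs') (by rwa [h2 hs, h2 hs'] at e)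
      linarith
  · conv_lhs => rw [← hu, image_union, h1.image_eq, h2.image_eq]
    congr 1
    · ext x
      constructor
      · rintro ⟨s, hs, rfl⟩
        exact ⟨_, m1 hs, rfl⟩
      · rintro ⟨s, hs, rfl⟩
        exact ⟨s / 2, ⟨by linarith [hs.1], by linarith [hs.2]⟩, by dsimp only; congr 1; ring⟩
    · ext x
      constructor
      · rintro ⟨s, hs, rfl⟩
        exact ⟨_, m2 hs, rfl⟩
      · rintro ⟨s, hs, rfl⟩
        exact ⟨(s + 1) / 2, ⟨by linarith [hs.1], by linarith [hs.2]⟩,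
          by dsimp only; congr 1; ring⟩
  · rw [h1 (by norm_num)]; simp
  · rw [h2 (by norm_num)]; norm_num

end IsArc

lemma subset_or_subset_of_isClosed {C L R : Set Plane} (hC : IsPreconnected C) (hL : IsClosed L)
    (hR : IsClosed R) (h : C ⊆ L ∪ R) (hd : ∀ x ∈ C, x ∈ L → x ∉ R) : C ⊆ L ∨ C ⊆ R := by
  by_contra! hne
  obtain ⟨⟨x, hx, hxL⟩, y, hy, hyR⟩ := And.imp not_subset.1 not_subset.1 hne
  obtain ⟨z, hz, hzL, hzR⟩ := isPreconnected_closed_iff.1 hC L R hL hR h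
    ⟨y, hy, (h hy).resolve_right hyR⟩ ⟨x, hx, (h hx).resolve_left hxL⟩
  exact hd z hz hzL hzR

/-- An arc in the union of two closed sets with one common point lies in one of them, unless this
point is an inner point of the arc. -/
lemma IsArc.subset_or_subset {A L R : Set Plane} {p q o : Plane} (hA : IsArc A p q)
    (hL : IsClosed L) (hR : IsClosed R) (h : A ⊆ L ∪ R) (hLR : L ∩ R ⊆ {o})
    (ho : o ∈ A → o = p ∨ o = q) : A ⊆ L ∨ A ⊆ R := by
  -- Without its end `o` the arc is still connected and misses the common point, so it lies in one
  -- closed set; taking the closure returns the end.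
  have main : ∀ {p q : Plane}, IsArc A p q → o = q → A ⊆ L ∨ A ⊆ R := by
    rintro p q ⟨γ, hc, hi, rfl, rfl, rfl⟩ rfl
    have hc' : closure (Ico (0 : ℝ) 1) = Icc 0 1 := closure_Ico (by norm_num)
    have hcl {F : Set Plane} (hF : IsClosed F) (h : γ '' Ico 0 1 ⊆ F) : γ '' Icc 0 1 ⊆ F := by
      rw [← hc'] at hc ⊢
      exact (hc.image_closure).trans (closure_minimal h hF)
    refine (subset_or_subset_of_isClosed (isPreconnected_Ico.image γ (hc.mono Ico_subset_Icc_self))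
      hL hR ((image_mono Ico_subset_Icc_self).trans h) ?_).imp (hcl hL) (hcl hR)
    rintro _ ⟨s, hs, rfl⟩ h1 h2
    exact hs.2.ne (hi (Ico_subset_Icc_self hs) (by simp) (hLR ⟨h1, h2⟩))
  by_cases hoA : o ∈ A
  · rcases ho hoA with h | h
    · exact main hA.symm h
    · exact main hA h
  · exact subset_or_subset_of_isClosed hA.isPreconnected hL hR h fun x hx h1 h2 =>
      hoA (hLR ⟨h1, h2⟩ ▸ hx)

lemma isArc_graph {X : ℝ → ℝ} (hX : Continuous X) {a b : ℝ} (hab : a < b) :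
    IsArc {p | p.1 = X p.2 ∧ a ≤ p.2 ∧ p.2 ≤ b} (X a, a) (X b, b) := by
  have hba : 0 < b - a := by linarith
  refine ⟨fun s => (X (a + s * (b - a)), a + s * (b - a)), Continuous.continuousOn (by fun_prop),
    ?_, ?_, by simp, by simp⟩
  · intro s _ s' _ e
    have := congrArg Prod.snd e
    dsimp only at this
    exact mul_right_cancel₀ hba.ne' (add_left_cancel this)
  · ext p
    constructor
    · rintro ⟨s, hs, rfl⟩
      refine ⟨rfl, ?_, ?_⟩
      · have := mul_nonneg hs.1 hba.le; dsimp only; linarith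
      · have := mul_le_mul_of_nonneg_right hs.2 hba.le; dsimp only; linarith
    · rintro ⟨h1, h2, h3⟩
      have : a + (p.2 - a) / (b - a) * (b - a) = p.2 := by field_simp; ring
      refine ⟨(p.2 - a) / (b - a), ⟨div_nonneg (by linarith) hba.le,
        (div_le_one hba).2 (by linarith)⟩, Prod.ext ?_ ?_⟩
      · dsimp only; rw [this, h1]
      · exact this

/-! ### Bands with one critical level -/

/-- The strand of type `t` of the band `[h, H]` with the critical level `g`: a graph over the lower
half of the band for `B`, over the upper one for `D`, and over the whole band for `C`. -/
def strandSet (h g H : ℝ) (t : Symbol) (X : ℝ → ℝ) : Set Plane :=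
  {p | p.1 = X p.2 ∧ (if t = Symbol.D then g else h) ≤ p.2 ∧
    p.2 ≤ (if t = Symbol.B then g else H)}

/-- A presentation of the boundary in the band `[h, H]` by strands listed from left to right. -/
structure Strip (S : Set Plane) (h g H : ℝ) where
  n : ℕ
  ty : ℕ → Symbol
  X : ℕ → ℝ → ℝ
  lt_mid : h < g
  mid_lt : g < H
  ty_ne : ∀ i < n, ty i ≠ Symbol.sep
  continuous_X : ∀ i, Continuous (X i)
  bandBoundary_eq : ∀ p, p ∈ bandBoundary S h H ↔ ∃ i < n, p ∈ strandSet h g H (ty i) (X i)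
  X_lt : ∀ i j, i < j → j < n → ∀ p ∈ strandSet h g H (ty i) (X i),
    ∀ q ∈ strandSet h g H (ty j) (X j), p.2 = q.2 → p.2 ≠ g → p.1 < q.1
  X_le : ∀ i j, i < j → j < n → X i g ≤ X j g
  single : ∀ i < n, ty i = Symbol.C → ∀ k < n, X k g = X i g → k = i
  pair : ∀ i < n, ty i ≠ Symbol.C → ∃ j < n, j ≠ i ∧ ty j = ty i ∧
    ∀ k < n, X k g = X i g ↔ k = i ∨ k = j
  isUnicritical : IsUnicritical S h H
  eq_mid : ∀ c ∈ Icc h H, IsCritical (frontier S) c → c = g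

namespace Strip

variable {S : Set Plane} {h g H : ℝ} (T : Strip S h g H)

def strand (i : ℕ) : Set Plane := strandSet h g H (T.ty i) (T.X i)

def start (i : ℕ) : ℝ := if T.ty i = Symbol.D then g else h

def finish (i : ℕ) : ℝ := if T.ty i = Symbol.B then g else H

/-- The union of the strands with the same point on the critical level. -/
def piece (x : ℝ) : Set Plane := ⋃ i ∈ {i | i < T.n ∧ T.X i g = x}, T.strand i

variable {T} {i j : ℕ}

lemma start_lt_finish : T.start i < T.finish i := by
  have := T.lt_mid
  have := T.mid_lt
  unfold start finish
  split_ifs with h1 h2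
  · rw [h1] at h2; cases h2
  all_goals linarith

lemma isArc_strand : IsArc (T.strand i) (T.X i (T.start i), T.start i)
    (T.X i (T.finish i), T.finish i) := isArc_graph (T.continuous_X i) start_lt_finish

lemma isCrossing_strand : IsCrossing (T.strand i) :=
  ⟨_, _, isArc_strand, fun _ hx => hx.2⟩

lemma isClosed_strand : IsClosed (T.strand i) :=
  (isClosed_eq continuous_fst ((T.continuous_X i).comp continuous_snd)).inter
    ((isClosed_le continuous_const continuous_snd).inter
      (isClosed_le continuous_snd continuous_const))

lemma mid_mem_strand : (T.X i g, g) ∈ T.strand i := by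
  have := T.lt_mid.le
  have := T.mid_lt.le
  refine ⟨rfl, ?_, ?_⟩ <;> dsimp only <;> split_ifs <;> first | exact le_rfl | assumption

lemma strand_subset (hi : i < T.n) : T.strand i ⊆ bandBoundary S h H :=
  fun p hp => (T.bandBoundary_eq p).2 ⟨i, hi, hp⟩

/-- Off the critical level the strands are strictly ordered from left to right, so two of them can
meet only on it. -/
lemma mid_of_mem {p : Plane} (hi : i < T.n) (hj : j < T.n) (hij : i ≠ j) (h1 : p ∈ T.strand i)
    (h2 : p ∈ T.strand j) : p = (T.X i g, g) ∧ T.X i g = T.X j g := by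
  have hg : p.2 = g := by
    by_contra hg
    rcases hij.lt_or_gt with hij | hij
    · exact (T.X_lt i j hij hj p h1 p h2 rfl hg).false
    · exact (T.X_lt j i hij hi p h2 p h1 rfl hg).false
  have e1 := h1.1
  have e2 := h2.1
  rw [hg] at e1 e2
  exact ⟨Prod.ext e1 hg, e1.symm.trans e2⟩

lemma disjoint_strand (hi : i < T.n) (hj : j < T.n) (hij : T.X i g ≠ T.X j g) :
    Disjoint (T.strand i) (T.strand j) :=
  Set.disjoint_left.2 fun _ h1 h2 =>
    hij (mid_of_mem hi hj (fun h => hij (by rw [h])) h1 h2).2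

lemma not_disjoint_strand (hij : T.X i g = T.X j g) :
    ¬ Disjoint (T.strand i) (T.strand j) :=
  Set.not_disjoint_iff.2 ⟨_, mid_mem_strand, hij ▸ mid_mem_strand⟩

lemma isClosed_biUnion_strand (s : Set ℕ) (hs : s ⊆ Iio T.n) :
    IsClosed (⋃ i ∈ s, T.strand i) :=
  ((finite_Iio T.n).subset hs).isClosed_biUnion fun _ _ => isClosed_strand

lemma strand_subset_piece (hi : i < T.n) : T.strand i ⊆ T.piece (T.X i g) :=
  subset_biUnion_of_mem (u := T.strand) (show i ∈ {k | k < T.n ∧ T.X k g = T.X i g} from ⟨hi, rfl⟩)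

/-- A connected part of the boundary in the band lies in one piece. -/
lemma subset_piece {C : Set Plane} (hC : IsPreconnected C) (hCS : C ⊆ bandBoundary S h H)
    {x : ℝ} {p : Plane} (hpC : p ∈ C) (hp : p ∈ T.piece x) : C ⊆ T.piece x := by
  set Q := ⋃ i ∈ {i | i < T.n ∧ T.X i g ≠ x}, T.strand i with hQ
  have hd : ∀ y, y ∈ T.piece x → y ∉ Q := by
    intro y h1 h2
    obtain ⟨i, ⟨hi, hix⟩, hyi⟩ := mem_iUnion₂.1 h1
    obtain ⟨j, ⟨hj, hjx⟩, hyj⟩ := mem_iUnion₂.1 h2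
    exact Set.disjoint_left.1 (disjoint_strand hi hj (by rw [hix]; exact hjx.symm)) hyi hyj
  refine (subset_or_subset_of_isClosed hC (isClosed_biUnion_strand _ fun i hi => hi.1)
    (isClosed_biUnion_strand {i | i < T.n ∧ T.X i g ≠ x} fun i hi => hi.1) ?_ fun y _ =>
      hd y).resolve_right fun hCQ => hd p hp (hCQ hpC)
  intro y hy
  obtain ⟨i, hi, hyi⟩ := (T.bandBoundary_eq y).1 (hCS hy)
  by_cases hx : T.X i g = x
  · exact Or.inl (mem_iUnion₂.2 ⟨i, ⟨hi, hx⟩, hyi⟩)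
  · exact Or.inr (mem_iUnion₂.2 ⟨i, ⟨hi, hx⟩, hyi⟩)

lemma piece_of_single (hi : i < T.n) (ht : T.ty i = Symbol.C) :
    T.piece (T.X i g) = T.strand i := by
  refine Subset.antisymm (iUnion₂_subset ?_) (strand_subset_piece hi)
  rintro k ⟨hk, hki⟩
  rw [T.single i hi ht k hk hki]

lemma piece_of_pair (hi : i < T.n) (hj : j < T.n)
    (hk : ∀ k < T.n, T.X k g = T.X i g ↔ k = i ∨ k = j) :
    T.piece (T.X i g) = T.strand i ∪ T.strand j := by
  refine Subset.antisymm (iUnion₂_subset ?_) (union_subset (strand_subset_piece hi) ?_)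
  · rintro k ⟨hk', hki⟩
    rcases (hk k hk').1 hki with rfl | rfl
    · exact subset_union_left
    · exact subset_union_right
  · rw [← (hk j hj).2 (Or.inr rfl)]
    exact strand_subset_piece hj

lemma inter_subset (hi : i < T.n) (hj : j < T.n) (hij : i ≠ j) :
    T.strand i ∩ T.strand j ⊆ {(T.X i g, g)} :=
  fun _ hp => (mid_of_mem hi hj hij hp.1 hp.2).1

lemma isBirth_union (hi : i < T.n) (hj : j < T.n) (hij : i ≠ j) (e : T.X i g = T.X j g)
    (h1 : T.ty i = Symbol.B) (h2 : T.ty j = Symbol.B) : IsBirth (T.strand i ∪ T.strand j) := by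
  have a1 := T.isArc_strand (i := i)
  have a2 := (T.isArc_strand (i := j)).symm
  have hs : T.finish i = g := by simp [finish, h1]
  have hs' : T.finish j = g := by simp [finish, h2]
  rw [hs] at a1
  rw [hs', ← e] at a2
  have s1 : T.start i = h := by simp [start, h1]
  have s2 : T.start j = h := by simp [start, h2]
  refine ⟨_, _, a1.union a2 (inter_subset hi hj hij), s1.trans s2.symm, ?_⟩
  rintro x (hx | hx)
  · exact hx.2.1
  · exact (s1.trans s2.symm).le.trans hx.2.1

lemma isDeath_union (hi : i < T.n) (hj : j < T.n) (hij : i ≠ j) (e : T.X i g = T.X j g)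
    (h1 : T.ty i = Symbol.D) (h2 : T.ty j = Symbol.D) : IsDeath (T.strand i ∪ T.strand j) := by
  have a1 := (T.isArc_strand (i := i)).symm
  have a2 := T.isArc_strand (i := j)
  have hs : T.start i = g := by simp [start, h1]
  have hs' : T.start j = g := by simp [start, h2]
  rw [hs] at a1
  rw [hs', ← e] at a2
  have s1 : T.finish i = H := by simp [finish, h1]
  have s2 : T.finish j = H := by simp [finish, h2]
  refine ⟨_, _, a1.union a2 (inter_subset hi hj hij), s1.trans s2.symm, ?_⟩
  rintro x (hx | hx)
  · exact hx.2.2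
  · exact hx.2.2.trans (s1.trans s2.symm).ge

lemma hasType_piece (hi : i < T.n) : HasType (T.piece (T.X i g)) (T.ty i) := by
  by_cases hC : T.ty i = Symbol.C
  · rw [piece_of_single hi hC, hC]
    exact isCrossing_strand
  · obtain ⟨j, hj, hji, ht, hk⟩ := T.pair i hi hC
    have e := (hk j hj).2 (Or.inr rfl)
    rw [piece_of_pair hi hj hk]
    have hsep := T.ty_ne i hi
    cases hti : T.ty i with
    | B => exact isBirth_union hi hj hji.symm e.symm hti (ht.trans hti)
    | C => exact absurd hti hC
    | D => exact isDeath_union hi hj hji.symm e.symm hti (ht.trans hti)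
    | sep => exact absurd hti hsep

lemma isPreconnected_piece (hi : i < T.n) : IsPreconnected (T.piece (T.X i g)) := by
  have := hasType_piece hi
  cases hti : T.ty i with
  | sep => exact absurd hti (T.ty_ne i hi)
  | _ =>
    rw [hti] at this
    obtain ⟨p, q, h, -⟩ := this
    exact h.isPreconnected

/-- A piece is itself an arc, hence connected, and no connected part of the boundary in the band
leaves it. -/
lemma connectedComponentIn_eq (hi : i < T.n) :
    connectedComponentIn (bandBoundary S h H) (T.X i g, g) = T.piece (T.X i g) := by
  have hm : ((T.X i g, g) : Plane) ∈ T.piece (T.X i g) := strand_subset_piece hi mid_mem_strand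
  apply Subset.antisymm
  · exact subset_piece isPreconnected_connectedComponentIn (connectedComponentIn_subset _ _)
      (mem_connectedComponentIn (strand_subset hi mid_mem_strand)) hm
  · exact (isPreconnected_piece hi).subset_connectedComponentIn hm
      (iUnion₂_subset fun k hk => strand_subset hk.1)

lemma hasComponentType_strand (hi : i < T.n) :
    HasComponentType S h H (T.strand i) (T.ty i) :=
  ⟨_, mid_mem_strand, by rw [connectedComponentIn_eq hi]; exact hasType_piece hi⟩

/-! ### Crossing components are exactly the strands -/

/-- A crossing subarc lies in one strand. -/
lemma exists_subset_strand {A : Set Plane} (hA : IsCrossing A) (hAS : A ⊆ bandBoundary S h H) :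
    ∃ i < T.n, A ⊆ T.strand i := by
  obtain ⟨p, q, hpq, hr⟩ := hA
  obtain ⟨i, hi, hpi⟩ := (T.bandBoundary_eq p).1 (hAS hpq.left_mem)
  have hsub := subset_piece hpq.isPreconnected hAS hpq.left_mem (strand_subset_piece hi hpi)
  by_cases hC : T.ty i = Symbol.C
  · exact ⟨i, hi, by rwa [piece_of_single hi hC] at hsub⟩
  · obtain ⟨j, hj, hji, ht, hk⟩ := T.pair i hi hC
    have e := (hk j hj).2 (Or.inr rfl)
    rw [piece_of_pair hi hj hk] at hsub
    have hmid : ∀ x ∈ A, x.2 = g → x = (T.X i g, g) := by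
      intro x hx hxg
      refine Prod.ext ?_ hxg
      rcases hsub hx with h | h
      · rw [h.1, hxg]
      · rw [h.1, hxg, e]
    -- The joint of a pair has the largest height of the pair for `B` and the smallest for `D`. A
    -- crossing arc takes its extreme heights at its ends, so it cannot pass through the joint and
    -- go on.
    have ho : ((T.X i g, g) : Plane) ∈ A → (T.X i g, g) = p ∨ (T.X i g, g) = q := by
      intro hoA
      cases hti : T.ty i with
      | B =>
        right
        refine (hmid q hpq.right_mem (le_antisymm ?_ (hr _ hoA).2)).symm
        rcases hsub hpq.right_mem with h | h
        · exact h.2.2.trans (if_pos hti).le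
        · exact h.2.2.trans (if_pos (ht.trans hti)).le
      | C => exact absurd hti hC
      | D =>
        left
        refine (hmid p hpq.left_mem (le_antisymm (hr _ hoA).1 ?_)).symm
        rcases hsub hpq.left_mem with h | h
        · exact (if_pos hti).ge.trans h.2.1
        · exact (if_pos (ht.trans hti)).ge.trans h.2.1
      | sep => exact absurd hti (T.ty_ne i hi)
    rcases hpq.subset_or_subset isClosed_strand isClosed_strand hsub (inter_subset hi hj hji.symm)
      ho with h | h
    · exact ⟨i, hi, h⟩
    · exact ⟨j, hj, h⟩

/-- Different strands share at most one point, while the two ends of a strand have different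
heights. -/
lemma eq_of_strand_subset (hi : i < T.n) (hj : j < T.n) (hs : T.strand i ⊆ T.strand j) :
    i = j := by
  by_contra hij
  have h1 := (mid_of_mem hi hj hij isArc_strand.left_mem (hs isArc_strand.left_mem)).1
  have h2 := (mid_of_mem hi hj hij isArc_strand.right_mem (hs isArc_strand.right_mem)).1
  have := T.start_lt_finish (i := i)
  rw [Prod.mk.injEq] at h1 h2
  linarith [h1.2, h2.2]

/-- Every crossing subarc lies in a strand and no strand lies in another one, so the strands are the
maximal ones. -/
lemma isCrossingComponent_iff {A : Set Plane} :
    IsCrossingComponent S h H A ↔ ∃ i < T.n, A = T.strand i := by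
  constructor
  · rintro ⟨h1, h2, h3⟩
    obtain ⟨i, hi, hA⟩ := exists_subset_strand (T := T) h2 h1
    exact ⟨i, hi, (h3 _ hA (strand_subset hi) isCrossing_strand).symm⟩
  · rintro ⟨i, hi, rfl⟩
    refine ⟨strand_subset hi, isCrossing_strand, fun A' h1 h2 h3 => ?_⟩
    obtain ⟨j, hj, hA⟩ := exists_subset_strand (T := T) h3 h2
    obtain rfl := eq_of_strand_subset hi hj (h1.trans hA)
    exact Subset.antisymm hA h1

lemma finite_crossingComponents (T : Strip S h g H) : {A | IsCrossingComponent S h H A}.Finite :=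
  ((finite_Iio T.n).image T.strand).subset fun A hA => by
    obtain ⟨i, hi, rfl⟩ := (isCrossingComponent_iff (T := T)).1 hA
    exact ⟨i, hi, rfl⟩

/-! ### Positions of the strands -/

lemma isEnd_mem {A : Set Plane} {p : Plane} (hp : IsEnd A p) : p ∈ A := hp.choose_spec.left_mem

/-- The components counted for `i` are counted for `j` as well, and strand `i` itself is counted for
`j` only. -/
lemma endPosition_lt (hi : i < T.n) {c : ℝ}
    (h1 : IsEnd (T.strand i) (T.X i c, c)) (h2 : IsEnd (T.strand j) (T.X j c, c))
    (hlt : T.X i c < T.X j c) :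
    endPosition S h H c (T.strand i) < endPosition S h H c (T.strand j) := by
  apply Set.ncard_lt_ncard _ (T.finite_crossingComponents.subset fun A hA => hA.1)
  refine Set.ssubset_iff_of_subset ?_ |>.2
    ⟨T.strand i, ⟨isCrossingComponent_iff.2 ⟨i, hi, rfl⟩, _, _, h2, rfl, h1, rfl, hlt⟩, ?_⟩
  · rintro A ⟨hA, p, q, hp, hpc, hq, hqc, hqp⟩
    refine ⟨hA, _, q, h2, rfl, hq, hqc, ?_⟩
    have := (isEnd_mem hp).1
    rw [hpc] at this
    exact (hqp.trans_eq this).trans hlt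
  · rintro ⟨-, p, q, hp, hpc, hq, hqc, hqp⟩
    rw [(isEnd_mem hp).1, (isEnd_mem hq).1, hpc, hqc] at hqp
    exact hqp.false

lemma endPosition_eq_zero {c : ℝ} (hc : ∀ p ∈ T.strand i, p.2 ≠ c) :
    endPosition S h H c (T.strand i) = 0 := by
  have : {A' | IsCrossingComponent S h H A' ∧ ∃ p q, IsEnd (T.strand i) p ∧ p.2 = c ∧
      IsEnd A' q ∧ q.2 = c ∧ q.1 < p.1} = ∅ := by
    refine eq_empty_of_forall_notMem ?_
    rintro A ⟨-, p, -, hp, hpc, -⟩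
    exact hc p (isEnd_mem hp) hpc
  rw [endPosition, this, ncard_empty]

lemma lowerPosition_lt (hj : j < T.n) (hij : i < j)
    (h1 : T.ty i = Symbol.B) (h2 : T.ty j = Symbol.B) :
    lowerPosition S h H (T.strand i) < lowerPosition S h H (T.strand j) := by
  have a1 := T.isArc_strand (i := i)
  have a2 := T.isArc_strand (i := j)
  have lt := T.X_lt i j hij hj _ a1.left_mem _ a2.left_mem
  have s1 : T.start i = h := by simp [start, h1]
  have s2 : T.start j = h := by simp [start, h2]
  rw [s1] at a1 lt
  rw [s2] at a2 lt
  exact endPosition_lt (hij.trans hj) ⟨_, a1⟩ ⟨_, a2⟩ (lt rfl T.lt_mid.ne)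

lemma upperPosition_lt (hj : j < T.n) (hij : i < j)
    (h1 : T.ty i = Symbol.D) (h2 : T.ty j = Symbol.D) :
    upperPosition S h H (T.strand i) < upperPosition S h H (T.strand j) := by
  have a1 := (T.isArc_strand (i := i)).symm
  have a2 := (T.isArc_strand (i := j)).symm
  have lt := T.X_lt i j hij hj _ a1.left_mem _ a2.left_mem
  have s1 : T.finish i = H := by simp [finish, h1]
  have s2 : T.finish j = H := by simp [finish, h2]
  rw [s1] at a1 lt
  rw [s2] at a2 lt
  exact endPosition_lt (hij.trans hj) ⟨_, a1⟩ ⟨_, a2⟩ (lt rfl T.mid_lt.ne')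

/-- With the next lemma this refutes the clause of `LeftOf` for the opposite type: both positions
there vanish, so it need not be shown that the union of a pair of type `B` is not of type `D`. -/
lemma upperPosition_eq_zero (h1 : T.ty i = Symbol.B) :
    upperPosition S h H (T.strand i) = 0 :=
  endPosition_eq_zero fun _ hp => ((hp.2.2.trans (if_pos h1).le).trans_lt T.mid_lt).ne

lemma lowerPosition_eq_zero (h1 : T.ty i = Symbol.D) :
    lowerPosition S h H (T.strand i) = 0 :=
  endPosition_eq_zero fun _ hp => (T.lt_mid.trans_le ((if_pos h1).ge.trans hp.2.1)).ne'

lemma leftOf_of_lt (hj : j < T.n) (hij : i < j) :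
    LeftOf S h H g (T.strand i) (T.strand j) := by
  have hi := hij.trans hj
  by_cases e : T.X i g = T.X j g
  · by_cases hC : T.ty i = Symbol.C
    · exact absurd (T.single i hi hC j hj e.symm) hij.ne'
    · obtain ⟨j', hj', -, ht, hk⟩ := T.pair i hi hC
      obtain rfl : j = j' := ((hk j hj).1 e.symm).resolve_left hij.ne'
      cases hti : T.ty i with
      | B => exact Or.inr (Or.inl ⟨not_disjoint_strand e,
          isBirth_union hi hj hij.ne e hti (ht.trans hti),
          lowerPosition_lt hj hij hti (ht.trans hti)⟩)
      | C => exact absurd hti hC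
      | D => exact Or.inr (Or.inr ⟨not_disjoint_strand e,
          isDeath_union hi hj hij.ne e hti (ht.trans hti),
          upperPosition_lt hj hij hti (ht.trans hti)⟩)
      | sep => exact absurd hti (T.ty_ne i hi)
  · refine Or.inl ⟨disjoint_strand hi hj e, fun p hp q hq h1 h2 => ?_⟩
    rw [hp.1, hq.1, h1, h2]
    exact (T.X_le i j hij hj).lt_of_ne e

lemma not_leftOf_of_le (hj : j < T.n) (hij : i ≤ j) :
    ¬ LeftOf S h H g (T.strand j) (T.strand i) := by
  have hi := hij.trans_lt hj
  rcases hij.eq_or_lt with rfl | hij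
  · rintro (h | h | h)
    · exact not_disjoint_strand rfl h.1
    · exact h.2.2.false
    · exact h.2.2.false
  by_cases e : T.X i g = T.X j g
  · by_cases hC : T.ty i = Symbol.C
    · exact absurd (T.single i hi hC j hj e.symm) hij.ne'
    · obtain ⟨j', hj', -, ht, hk⟩ := T.pair i hi hC
      obtain rfl : j = j' := ((hk j hj).1 e.symm).resolve_left hij.ne'
      rintro (h | h | h)
      · exact not_disjoint_strand e.symm h.1
      · cases hti : T.ty i with
        | B => exact h.2.2.asymm (lowerPosition_lt hj hij hti (ht.trans hti))
        | C => exact hC hti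
        | D =>
          have := h.2.2
          rw [lowerPosition_eq_zero hti, lowerPosition_eq_zero (ht.trans hti)] at this
          exact this.false
        | sep => exact T.ty_ne i hi hti
      · cases hti : T.ty i with
        | B =>
          have := h.2.2
          rw [upperPosition_eq_zero hti, upperPosition_eq_zero (ht.trans hti)] at this
          exact this.false
        | C => exact hC hti
        | D => exact h.2.2.asymm (upperPosition_lt hj hij hti (ht.trans hti))
        | sep => exact T.ty_ne i hi hti
  · rintro (h | h | h)
    · exact (h.2 _ mid_mem_strand _ mid_mem_strand rfl rfl).not_ge (T.X_le i j hij hj)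
    · exact h.1 (disjoint_strand hj hi (Ne.symm e))
    · exact h.1 (disjoint_strand hj hi (Ne.symm e))

/-- The components on the left of strand `i` are the strands of smaller index, so the counted sets
are strictly nested. -/
lemma position_lt (hj : j < T.n) (hij : i < j) :
    position S h H g (T.strand i) < position S h H g (T.strand j) := by
  have hi := hij.trans hj
  apply Set.ncard_lt_ncard _ (T.finite_crossingComponents.subset fun A hA => hA.1)
  refine Set.ssubset_iff_of_subset ?_ |>.2
    ⟨T.strand i, ⟨isCrossingComponent_iff.2 ⟨i, hi, rfl⟩, leftOf_of_lt hj hij⟩,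
      fun h => not_leftOf_of_le hi le_rfl h.2⟩
  rintro A ⟨hA, hAi⟩
  refine ⟨hA, ?_⟩
  obtain ⟨k, hk, rfl⟩ := (isCrossingComponent_iff (T := T)).1 hA
  rcases lt_or_ge k i with hki | hki
  · exact leftOf_of_lt hj (hki.trans hij)
  · exact absurd hAi (not_leftOf_of_le hk hki)

lemma isCriptString (T : Strip S h g H) :
    IsCriptString S h H ((List.range T.n).map T.ty) := by
  refine ⟨T.isUnicritical, g, ⟨T.lt_mid, T.mid_lt⟩, T.eq_mid, (List.range T.n).map T.strand,
    ?_, ?_, ?_⟩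
  · intro A
    rw [T.isCrossingComponent_iff]
    simp [eq_comm]
  · rw [List.pairwise_map]
    refine List.pairwise_lt_range.imp_of_mem fun _ hj hij => ?_
    exact position_lt (List.mem_range.1 hj) hij
  · rw [List.forall₂_map_left_iff, List.forall₂_map_right_iff, List.forall₂_same]
    exact fun i hi => hasComponentType_strand (List.mem_range.1 hi)

end Strip
/-! ### Strings -/

/-- The letters of the components that reach the lower level of the band. -/
def Symbol.isLow : Symbol → Bool
  | .B => true
  | .C => true
  | _ => false

/-- The letters of the components that reach the upper level of the band. -/
def Symbol.isUp : Symbol → Bool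
  | .C => true
  | .D => true
  | _ => false

@[simp] lemma Symbol.isLow_B : Symbol.B.isLow = true := rfl
@[simp] lemma Symbol.isLow_C : Symbol.C.isLow = true := rfl
@[simp] lemma Symbol.isLow_D : Symbol.D.isLow = false := rfl
@[simp] lemma Symbol.isLow_sep : Symbol.sep.isLow = false := rfl
@[simp] lemma Symbol.isUp_B : Symbol.B.isUp = false := rfl
@[simp] lemma Symbol.isUp_C : Symbol.C.isUp = true := rfl
@[simp] lemma Symbol.isUp_D : Symbol.D.isUp = true := rfl
@[simp] lemma Symbol.isUp_sep : Symbol.sep.isUp = false := rfl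

/-- The symbol at the place `i`, or `sep` outside the word. -/
def letter (u : List Symbol) (i : ℕ) : Symbol := u.getD i Symbol.sep

/-- The number of letters with the property `P` before the place `i`. -/
def rank (P : Symbol → Bool) (u : List Symbol) (i : ℕ) : ℕ := (u.take i).countP P

/-- The letter at the place `i` is the second one of a pair `BB` or `DD`. -/
def IsSecond (u : List Symbol) (i : ℕ) : Prop :=
  Odd ((u.take i).count Symbol.B) ∨ Odd ((u.take i).count Symbol.D)

open Classical in
/-- The position of the letter `i` on the critical level; it is common for the letters of a
pair. -/
noncomputable def midPos (u : List Symbol) (i : ℕ) : ℕ := if IsSecond u i then i - 1 else i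

variable {u : List Symbol} {P : Symbol → Bool} {t : Symbol} {i j : ℕ}

lemma letter_eq_iff (ht : t ≠ Symbol.sep) : letter u i = t ↔ u[i]? = some t := by
  rw [letter, List.getD_eq_getElem?_getD]
  cases h : u[i]? <;> simp [ht.symm]

lemma lt_length_of_letter (h : letter u i ≠ Symbol.sep) : i < u.length := by
  by_contra hi
  exact h (by rw [letter, List.getD_eq_default _ _ (not_lt.1 hi)])

lemma letter_ne_sep (hs : Symbol.sep ∉ u) (hi : i < u.length) : letter u i ≠ Symbol.sep := by
  rw [letter, List.getD_eq_getElem _ _ hi]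
  exact fun h => hs (h ▸ List.getElem_mem hi)

lemma rank_succ (hi : i < u.length) :
    rank P u (i + 1) = rank P u i + if P (letter u i) then 1 else 0 := by
  rw [rank, rank, List.take_add_one, List.countP_append, letter, List.getD_eq_getElem _ _ hi,
    List.getElem?_eq_getElem hi]
  simp [List.countP_singleton]

lemma rank_mono (h : i ≤ j) : rank P u i ≤ rank P u j :=
  (List.take_sublist_take_left h).countP_le

lemma rank_lt (hi : i < u.length) (hP : P (letter u i)) (hij : i < j) :
    rank P u i < rank P u j := by
  have := rank_mono (P := P) (u := u) (Nat.succ_le_of_lt hij)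
  rw [Nat.succ_eq_add_one, rank_succ hi, if_pos hP] at this
  omega

lemma rank_lt_countP (hi : i < u.length) (hP : P (letter u i)) : rank P u i < u.countP P := by
  have := rank_lt hi hP hi
  rwa [rank, rank, List.take_length] at this

lemma exists_rank_eq (P : Symbol → Bool) (u : List Symbol) (v : ℕ) (hv : v < u.countP P) :
    ∃ i < u.length, P (letter u i) ∧ rank P u i = v := by
  induction u generalizing v with
  | nil => simp at hv
  | cons a u ih =>
    by_cases ha : P a
    · cases v with
      | zero => exact ⟨0, by simp, by simpa [letter] using ha, by simp [rank]⟩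
      | succ v =>
        rw [List.countP_cons_of_pos ha] at hv
        obtain ⟨i, h1, h2, h3⟩ := ih v (by omega)
        exact ⟨i + 1, by simpa using h1, by simpa [letter] using h2, by
          rw [rank, List.take_succ_cons, List.countP_cons_of_pos ha, ← h3, rank]⟩
    · rw [List.countP_cons_of_neg ha] at hv
      obtain ⟨i, h1, h2, h3⟩ := ih v hv
      exact ⟨i + 1, by simpa using h1, by simpa [letter] using h2, by
          rw [rank, List.take_succ_cons, List.countP_cons_of_neg ha, ← h3, rank]⟩

/-- The places of the letters with the property `P`. -/
def places (P : Symbol → Bool) (u : List Symbol) : Finset ℕ :=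
  (Finset.range u.length).filter fun i => P (letter u i)

lemma mem_places : i ∈ places P u ↔ i < u.length ∧ P (letter u i) := by
  simp [places]

lemma injOn_rank : InjOn (rank P u) (places P u) := by
  intro i hi j hj h
  have hi := mem_places.1 hi
  have hj := mem_places.1 hj
  rcases lt_trichotomy i j with hij | hij | hij
  · exact absurd h (rank_lt hi.1 hi.2 hij).ne
  · exact hij
  · exact absurd h (rank_lt hj.1 hj.2 hij).ne'

/-- The rank numbers the places with property `P` bijectively by an initial segment of the natural
numbers. This makes the strand ends on an outer level fill the vertices without gaps. -/
lemma card_filter_rank (P : Symbol → Bool) (u : List Symbol) (v : ℕ) :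
    ((places P u).filter (rank P u · = v)).card = if v < u.countP P then 1 else 0 := by
  split_ifs with hv
  · obtain ⟨i, hi, hP, rfl⟩ := exists_rank_eq P u v hv
    rw [Finset.card_eq_one]
    refine ⟨i, ?_⟩
    ext j
    simp only [Finset.mem_filter, Finset.mem_singleton]
    constructor
    · rintro ⟨hj, h⟩
      exact injOn_rank hj (mem_places.2 ⟨hi, hP⟩) h
    · rintro rfl
      exact ⟨mem_places.2 ⟨hi, hP⟩, rfl⟩
  · rw [Finset.card_eq_zero, Finset.filter_eq_empty_iff]
    rintro i hi rfl
    exact hv (rank_lt_countP (mem_places.1 hi).1 (mem_places.1 hi).2)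

lemma countP_isLow (u : List Symbol) :
    u.countP Symbol.isLow = u.count Symbol.B + u.count Symbol.C := by
  induction u with
  | nil => rfl
  | cons a u ih => cases a <;> simp [List.countP_cons, ih] <;> omega

lemma countP_isUp (u : List Symbol) :
    u.countP Symbol.isUp = u.count Symbol.D + u.count Symbol.C := by
  induction u with
  | nil => rfl
  | cons a u ih => cases a <;> simp [List.countP_cons, ih] <;> omega

/-! ### Pairs of letters -/

lemma count_take_succ (u : List Symbol) (t : Symbol) (i : ℕ) :
    (u.take (i + 1)).count t = (u.take i).count t + if u[i]? = some t then 1 else 0 := by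
  rw [List.take_add_one, List.count_append]
  cases h : u[i]? with
  | none => simp
  | some a => simp [List.count_singleton]

/-- The count becomes odd only after the first letter of a pair, and evenness makes the very next
letter restore it; so an odd prefix ends exactly between the two letters. -/
lemma EvennessFor.of_odd (h : EvennessFor t u) (ho : Odd ((u.take i).count t)) :
    u[i]? = some t ∧ ∃ k, i = k + 1 ∧ u[k]? = some t ∧ ¬ Odd ((u.take k).count t) := by
  induction i with
  | zero => simp at ho
  | succ i ih =>
    rw [count_take_succ] at ho
    split_ifs at ho with hi
    · have he : ¬ Odd ((u.take i).count t) := fun h' => by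
        rw [Nat.odd_add_one] at ho; exact ho h'
      exact ⟨h i hi (Nat.not_odd_iff_even.1 he), i, rfl, hi, he⟩
    · exact absurd (ih ho).1 hi

lemma EvennessFor.even_count (h : EvennessFor t u) : Even (u.count t) := by
  by_contra ho
  have := (h.of_odd (i := u.length) (by simpa using ho)).1
  simp at this

/-- A pair cannot straddle the separator. Hence `u` contains an even number of letters `t`, and
removing it keeps the parity of all counts in `v`. -/
lemma EvennessFor.of_append {v : List Symbol} (ht : t ≠ Symbol.sep)
    (h : EvennessFor t (u ++ Symbol.sep :: v)) : EvennessFor t u ∧ EvennessFor t v := by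
  have hu : EvennessFor t u := by
    intro i hi he
    have hlt : i < u.length := by
      by_contra hlt
      rw [List.getElem?_eq_none (not_lt.1 hlt)] at hi
      cases hi
    have := h i (by rwa [List.getElem?_append_left hlt])
      (by rwa [List.take_append_of_le_length hlt.le])
    rcases (Nat.succ_le_of_lt hlt).lt_or_eq with hlt' | heq
    · rwa [List.getElem?_append_left hlt'] at this
    · rw [List.getElem?_append_right (by omega), show i + 1 - u.length = 0 by omega] at this
      simp only [List.getElem?_cons_zero, Option.some.injEq] at this
      exact absurd this.symm ht
  refine ⟨hu, fun i hi he => ?_⟩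
  have e1 : ∀ k, (u ++ Symbol.sep :: v)[u.length + 1 + k]? = v[k]? := by
    intro k
    rw [List.getElem?_append_right (by omega),
      show u.length + 1 + k - u.length = k + 1 by omega, List.getElem?_cons_succ]
  have := h (u.length + 1 + i) (by rwa [e1]) ?_
  · rwa [add_assoc, e1] at this
  · rw [List.take_append, List.take_of_length_le (by omega),
      show u.length + 1 + i - u.length = i + 1 by omega, List.take_succ_cons, List.count_append,
      List.count_cons_of_ne ht.symm]
    exact hu.even_count.add he

lemma notMem_of_mem_splitOn {α : Type*} [DecidableEq α] (a : α) (w : List α) :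
    ∀ u ∈ w.splitOn a, a ∉ u := by
  induction w with
  | nil => simp
  | cons x w ih =>
    rw [List.splitOn_cons_eq_if_modifyHead]
    split_ifs with hx
    · rintro u (_ | ⟨_, hu⟩)
      · simp
      · exact ih u hu
    · obtain ⟨v, L, hL⟩ := List.exists_cons_of_ne_nil (List.splitOn_ne_nil a w)
      rw [hL] at ih ⊢
      rintro u (_ | ⟨_, hu⟩)
      · have := ih v (by simp)
        simp only [beq_iff_eq] at hx
        simp [this, Ne.symm hx]
      · exact ih u (List.mem_cons_of_mem _ hu)

lemma EvennessFor.of_intercalate (ht : t ≠ Symbol.sep) (L : List (List Symbol))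
    (h : EvennessFor t ([Symbol.sep].intercalate L)) : ∀ u ∈ L, EvennessFor t u := by
  induction L with
  | nil => simp
  | cons v L ih =>
    cases L with
    | nil => simpa using h
    | cons v' L =>
      rw [List.intercalate_cons_cons, List.append_assoc, List.singleton_append] at h
      obtain ⟨h1, h2⟩ := h.of_append ht
      rintro u (_ | ⟨_, hu⟩)
      · exact h1
      · exact ih h2 u hu

lemma midPos_le : midPos u i ≤ i := by
  unfold midPos; split_ifs <;> omega

lemma le_midPos : i ≤ midPos u i + 1 := by
  unfold midPos; split_ifs <;> omega

/-- A place is shifted by at most one to the left, which cannot invert the order. -/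
lemma midPos_mono (h : i ≤ j) : midPos u i ≤ midPos u j := by
  rcases h.eq_or_lt with rfl | h
  · exact le_rfl
  · have := midPos_le (u := u) (i := i)
    have := le_midPos (u := u) (i := j)
    omega

/-- Pairs of different types do not interleave: were the preceding letter a second one, of the same
type the parity would be wrong, and of the other type the letter itself would be. -/
lemma EvennessConditions.of_isSecond (hu : EvennessConditions u) (h : IsSecond u i) :
    ∃ k, i = k + 1 ∧ ¬ IsSecond u k ∧ ∃ t, (t = Symbol.B ∨ t = Symbol.D) ∧
      letter u i = t ∧ letter u k = t := by
  rcases h with h | h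
  · obtain ⟨h1, k, rfl, h2, h3⟩ := hu.1.of_odd h
    refine ⟨k, rfl, ?_, Symbol.B, Or.inl rfl, (letter_eq_iff (by simp)).2 h1,
      (letter_eq_iff (by simp)).2 h2⟩
    rintro (h | h)
    · exact h3 h
    · have := (hu.2.of_odd h).1
      simp [h2] at this
  · obtain ⟨h1, k, rfl, h2, h3⟩ := hu.2.of_odd h
    refine ⟨k, rfl, ?_, Symbol.D, Or.inr rfl, (letter_eq_iff (by simp)).2 h1,
      (letter_eq_iff (by simp)).2 h2⟩
    rintro (h | h)
    · have := (hu.1.of_odd h).1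
      simp [h2] at this
    · exact h3 h

lemma EvennessConditions.isSecond_succ (hu : EvennessConditions u) (h : ¬ IsSecond u i)
    (ht : letter u i = Symbol.B ∨ letter u i = Symbol.D) :
    IsSecond u (i + 1) ∧ letter u (i + 1) = letter u i := by
  rw [IsSecond, not_or] at h
  rcases ht with ht | ht
  · have h1 := (letter_eq_iff (by simp)).1 ht
    refine ⟨Or.inl ?_, ?_⟩
    · rw [count_take_succ, if_pos h1, Nat.odd_add_one]; exact h.1
    · rw [ht, letter_eq_iff (by simp)]
      exact hu.1 i h1 (Nat.not_odd_iff_even.1 h.1)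
  · have h1 := (letter_eq_iff (by simp)).1 ht
    refine ⟨Or.inr ?_, ?_⟩
    · rw [count_take_succ, if_pos h1, Nat.odd_add_one]; exact h.2
    · rw [ht, letter_eq_iff (by simp)]
      exact hu.2 i h1 (Nat.not_odd_iff_even.1 h.2)

/-- Since shifts are by at most one, a coincidence forces adjacent places with the right one
shifted, that is, a pair. -/
lemma EvennessConditions.midPos_eq_of_lt (hu : EvennessConditions u) (hij : i < j) (h : midPos u i = midPos u j) :
    j = i + 1 ∧ letter u j = letter u i ∧ (letter u i = Symbol.B ∨ letter u i = Symbol.D) := by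
  have h1 := midPos_le (u := u) (i := i)
  have h2 := le_midPos (u := u) (i := j)
  have hj : IsSecond u j := by
    by_contra hj
    rw [midPos.eq_1 u j, if_neg hj] at h
    omega
  obtain ⟨k, rfl, -, t, ht, e1, e2⟩ := hu.of_isSecond hj
  obtain rfl : k = i := by omega
  exact ⟨rfl, e1.trans e2.symm, e2.symm ▸ ht⟩

lemma EvennessConditions.exists_pair (hu : EvennessConditions u) (ht : letter u i = Symbol.B ∨ letter u i = Symbol.D) :
    ∃ j, j ≠ i ∧ letter u j = letter u i ∧ midPos u j = midPos u i := by
  by_cases h : IsSecond u i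
  · obtain ⟨k, rfl, hk, t, -, e1, e2⟩ := hu.of_isSecond h
    exact ⟨k, by omega, e2.trans e1.symm, by simp [midPos, h, hk]⟩
  · obtain ⟨h1, h2⟩ := hu.isSecond_succ h ht
    exact ⟨i + 1, by omega, h2, by simp [midPos, h, h1]⟩

/-- On the critical level either two strand ends meet or none. -/
lemma EvennessConditions.card_midPos (hu : EvennessConditions u) (v : ℕ) :
    ((places Symbol.isUp u).filter (midPos u · = v)).card +
        ((places Symbol.isLow u).filter (midPos u · = v)).card = 0 ∨
      ((places Symbol.isUp u).filter (midPos u · = v)).card +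
        ((places Symbol.isLow u).filter (midPos u · = v)).card = 2 := by
  -- Only the places `v` and `v + 1` can be drawn at `v`.
  have key (P : Symbol → Bool) (hP : P Symbol.sep = false) :
      (places P u).filter (midPos u · = v) =
        ({v, v + 1} : Finset ℕ).filter fun i => P (letter u i) ∧ midPos u i = v := by
    ext i
    simp only [Finset.mem_filter, mem_places, Finset.mem_insert, Finset.mem_singleton]
    constructor
    · rintro ⟨⟨-, h1⟩, h2⟩
      have h3 := midPos_le (u := u) (i := i)
      have h4 := le_midPos (u := u) (i := i)
      exact ⟨by omega, h1, h2⟩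
    · rintro ⟨-, h1, h2⟩
      exact ⟨⟨lt_length_of_letter fun h => by simp [h, hP] at h1, h1⟩, h2⟩
  rw [key _ rfl, key _ rfl]
  by_cases hv : IsSecond u v
  -- A second letter moves away to the left, and the place after it is never second, so nothing is
  -- drawn at `v`.
  · obtain ⟨k, rfl, -, -⟩ := hu.of_isSecond hv
    have h1 : midPos u (k + 1) ≠ k + 1 := by simp [midPos, hv]
    have h2 : midPos u (k + 1 + 1) ≠ k + 1 := by
      have : ¬ IsSecond u (k + 1 + 1) := by
        intro h
        obtain ⟨k', h3, h4, -⟩ := hu.of_isSecond h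
        obtain rfl : k' = k + 1 := by omega
        exact h4 hv
      simp [midPos, this]
    left
    simp [Finset.filter_insert, Finset.filter_singleton, h1, h2]
  · have h1 : midPos u v = v := by simp [midPos, hv]
    have h2 : midPos u (v + 1) = v ↔ letter u v = Symbol.B ∨ letter u v = Symbol.D := by
      constructor
      · intro h
        exact (hu.midPos_eq_of_lt (lt_add_one v) (h1.trans h.symm)).2.2
      · intro h
        simp [midPos, (hu.isSecond_succ hv h).1]
    -- The two ends at `v` are both below for a pair `BB`, both above for `DD`, and one on each side
    -- for `C`.
    cases hl : letter u v with
    | B =>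
      have h3 := (hu.isSecond_succ hv (Or.inl hl)).2
      rw [hl] at h3
      right
      simp [Finset.filter_insert, Finset.filter_singleton, h1, h2, hl, h3]
    | C =>
      right
      simp [Finset.filter_insert, Finset.filter_singleton, h1, h2, hl]
    | D =>
      have h3 := (hu.isSecond_succ hv (Or.inr hl)).2
      rw [hl] at h3
      right
      simp [Finset.filter_insert, Finset.filter_singleton, h1, h2, hl, h3]
    | sep =>
      left
      simp [Finset.filter_insert, Finset.filter_singleton, h1, h2, hl]
-- Stacking the bands into one drawing
/-- Strings of consecutive bands: the string `str z` belongs to the band `[2 * z, 2 * z + 2]`. -/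
structure BandStrings where
  str : ℤ → List Symbol
  n : ℕ
  range_of_ne : ∀ z, str z ≠ [] → -(n : ℤ) ≤ z ∧ z < 0
  exists_ne : ∃ z, str z ≠ []
  even : ∀ z, EvennessConditions (str z)
  sep_notMem : ∀ z, Symbol.sep ∉ str z
  balance : ∀ z, (str (z + 1)).countP Symbol.isLow = (str z).countP Symbol.isUp

namespace BandStrings

variable (W : BandStrings)

def layerStrands (t : ℤ) : Finset ℕ :=
  if t % 2 = 0 then places Symbol.isLow (W.str (t / 2)) else places Symbol.isUp (W.str (t / 2))

noncomputable def layerBot (t : ℤ) (i : ℕ) : ℕ :=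
  if t % 2 = 0 then rank Symbol.isLow (W.str (t / 2)) i else midPos (W.str (t / 2)) i

noncomputable def layerTop (t : ℤ) (i : ℕ) : ℕ :=
  if t % 2 = 0 then midPos (W.str (t / 2)) i else rank Symbol.isUp (W.str (t / 2)) i

lemma layerStrands_even (z : ℤ) : W.layerStrands (2 * z) = places Symbol.isLow (W.str z) := by
  simp [layerStrands]

lemma layerStrands_odd (z : ℤ) : W.layerStrands (2 * z + 1) = places Symbol.isUp (W.str z) := by
  rw [layerStrands, if_neg (by omega), show (2 * z + 1) / 2 = z by omega]

lemma layerBot_even (z : ℤ) : W.layerBot (2 * z) = rank Symbol.isLow (W.str z) := by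
  ext; simp [layerBot]

lemma layerBot_odd (z : ℤ) : W.layerBot (2 * z + 1) = midPos (W.str z) := by
  ext; rw [layerBot, if_neg (by omega), show (2 * z + 1) / 2 = z by omega]

lemma layerTop_even (z : ℤ) : W.layerTop (2 * z) = midPos (W.str z) := by
  ext; simp [layerTop]

lemma layerTop_odd (z : ℤ) : W.layerTop (2 * z + 1) = rank Symbol.isUp (W.str z) := by
  ext; rw [layerTop, if_neg (by omega), show (2 * z + 1) / 2 = z by omega]

lemma eq_even_or_odd (t : ℤ) : ∃ z, t = 2 * z ∨ t = 2 * z + 1 := ⟨t / 2, by omega⟩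

lemma str_ne_of_mem {t : ℤ} {i : ℕ} (hi : i ∈ W.layerStrands t) : W.str (t / 2) ≠ [] := by
  intro h
  simp [layerStrands, h, places] at hi

/-- The drawing of the strings: every band is drawn with the critical level in the middle. -/
noncomputable def drawing : Drawing where
  strands := W.layerStrands
  bot := W.layerBot
  top := W.layerTop
  lo := -2 * W.n
  hi := 0
  range_of_mem t i hi := by
    have := W.range_of_ne _ (W.str_ne_of_mem hi)
    omega
  exists_mem := by
    obtain ⟨z, hz⟩ := W.exists_ne
    have h0 : 0 < (W.str z).length := List.length_pos_of_ne_nil hz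
    have hsep := letter_ne_sep (W.sep_notMem z) h0
    cases hl : letter (W.str z) 0 with
    | B => exact ⟨2 * z, 0, by rw [layerStrands_even, mem_places]; simp [h0, hl]⟩
    | C => exact ⟨2 * z, 0, by rw [layerStrands_even, mem_places]; simp [h0, hl]⟩
    | D => exact ⟨2 * z + 1, 0, by rw [layerStrands_odd, mem_places]; simp [h0, hl]⟩
    | sep => exact absurd hl hsep
  mono t i hi j hj hij := by
    obtain ⟨z, rfl | rfl⟩ := eq_even_or_odd t
    · rw [layerStrands_even, mem_places] at hi
      rw [layerBot_even, layerTop_even]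
      exact ⟨rank_mono hij.le, midPos_mono hij.le, Or.inl (rank_lt hi.1 hi.2 hij)⟩
    · rw [layerStrands_odd, mem_places] at hi
      rw [layerBot_odd, layerTop_odd]
      exact ⟨midPos_mono hij.le, rank_mono hij.le, Or.inr (rank_lt hi.1 hi.2 hij)⟩
  degree t v := by
    obtain ⟨z, rfl | rfl⟩ := eq_even_or_odd t
    -- On an outer level each occupied vertex gets exactly one end from above and one from below;
    -- balance makes the two ranges of ranks equal.
    · have := W.balance (z - 1)
      rw [sub_add_cancel] at this
      rw [show 2 * z - 1 = 2 * (z - 1) + 1 by ring, layerStrands_even, layerBot_even,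
        layerStrands_odd, layerTop_odd, card_filter_rank, card_filter_rank, this]
      split_ifs <;> simp
    · rw [add_sub_cancel_right, layerStrands_even, layerTop_even, layerStrands_odd, layerBot_odd]
      exact (W.even z).card_midPos v

variable {W} {z : ℤ} {i : ℕ}

/-- The abscissa of the strand `i` of the band `z`. -/
noncomputable def abscissa (W : BandStrings) (z : ℤ) (i : ℕ) (y : ℝ) : ℝ :=
  if y ≤ 2 * z + 1 then W.drawing.X (2 * z) i y else W.drawing.X (2 * z + 1) i y

lemma X_mid_low (z : ℤ) (i : ℕ) :
    W.drawing.X (2 * z) i (2 * z + 1) = midPos (W.str z) i := by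
  have := Drawing.X_top (D := W.drawing) (2 * z) i
  push_cast at this
  rw [this]
  exact congrArg Nat.cast (congrFun (W.layerTop_even z) i)

lemma X_mid_up (z : ℤ) (i : ℕ) :
    W.drawing.X (2 * z + 1) i (2 * z + 1) = midPos (W.str z) i := by
  have := Drawing.X_bot (D := W.drawing) (2 * z + 1) i
  push_cast at this
  rw [this]
  exact congrArg Nat.cast (congrFun (W.layerBot_odd z) i)

lemma continuous_abscissa (z : ℤ) (i : ℕ) : Continuous (W.abscissa z i) :=
  Continuous.if_le (Drawing.continuous_X _ _) (Drawing.continuous_X _ _) continuous_id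
    continuous_const fun y hy => by
      obtain rfl : y = 2 * z + 1 := hy
      rw [X_mid_low, X_mid_up]

lemma abscissa_mid (z : ℤ) (i : ℕ) :
    W.abscissa z i (2 * z + 1) = midPos (W.str z) i := by
  rw [abscissa, if_pos le_rfl, X_mid_low]

lemma abscissa_low {y : ℝ} (hy : y ≤ 2 * z + 1) : W.abscissa z i y = W.drawing.X (2 * z) i y :=
  if_pos hy

lemma abscissa_up {y : ℝ} (hy : 2 * z + 1 ≤ y) :
    W.abscissa z i y = W.drawing.X (2 * z + 1) i y := by
  rcases hy.eq_or_lt with rfl | hy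
  · rw [abscissa_mid, X_mid_up]
  · exact if_neg (not_le.2 hy)

/-- The link between the strands of a strip and the half-band strands of the drawing. The two halves
have the same abscissa on the middle level, so the overlap there is harmless. -/
lemma mem_strandSet_iff (hi : i < (W.str z).length) {p : Plane} :
    p ∈ strandSet (2 * z) (2 * z + 1) (2 * z + 2) (letter (W.str z) i) (W.abscissa z i) ↔
      (i ∈ places Symbol.isLow (W.str z) ∧ p ∈ W.drawing.seg (2 * z, i)) ∨
      (i ∈ places Symbol.isUp (W.str z) ∧ p ∈ W.drawing.seg (2 * z + 1, i)) := by
  simp only [mem_places, hi, true_and, Drawing.seg, strandSet, Set.mem_ofPred_eq]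
  push_cast
  rcases le_total p.2 (2 * z + 1) with h | h
  · have h2 : p.2 ≤ 2 * z + 2 := by linarith
    have aux : (2 * z + 1 ≤ p.2) → W.drawing.X (2 * z + 1) i p.2 = W.drawing.X (2 * z) i p.2 := by
      intro h'
      rw [← abscissa_up h', abscissa_low h]
    have aux2 : (2 * (z : ℝ) + 1 ≤ p.2) → 2 * (z : ℝ) ≤ p.2 := by intro; linarith
    rw [abscissa_low h]
    cases hl : letter (W.str z) i with
    | sep => exact absurd hl (letter_ne_sep (W.sep_notMem z) hi)
    | B => simp; tauto
    | C =>
      simp only [reduceCtorEq, if_false, Symbol.isLow_C, Symbol.isUp_C, true_and]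
      constructor
      · rintro ⟨h1, h3, -⟩
        exact Or.inl ⟨h3, h, h1⟩
      · rintro (⟨h1, -, h3⟩ | ⟨h1, -, h3⟩)
        · exact ⟨h3, h1, h2⟩
        · exact ⟨h3.trans (aux h1), aux2 h1, h2⟩
    | D =>
      simp only [reduceCtorEq, if_false, if_true, Symbol.isLow_D, Symbol.isUp_D, true_and,
        Bool.false_eq_true, false_and, false_or]
      constructor
      · rintro ⟨h1, h3, -⟩
        exact ⟨h3, by linarith, h1.trans (aux h3).symm⟩
      · rintro ⟨h1, -, h3⟩
        exact ⟨h3.trans (aux h1), h1, h2⟩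
  · have h2 : 2 * (z : ℝ) ≤ p.2 := by linarith
    have aux : (p.2 ≤ 2 * z + 1) → W.drawing.X (2 * z) i p.2 = W.drawing.X (2 * z + 1) i p.2 := by
      intro h'
      rw [← abscissa_up h, abscissa_low h']
    rw [abscissa_up h]
    cases hl : letter (W.str z) i with
    | sep => exact absurd hl (letter_ne_sep (W.sep_notMem z) hi)
    | B =>
      simp only [reduceCtorEq, if_false, if_true, Symbol.isLow_B, Symbol.isUp_B, true_and,
        Bool.false_eq_true, false_and, or_false]
      constructor
      · rintro ⟨h1, -, h3⟩
        exact ⟨h2, h3, h1.trans (aux h3).symm⟩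
      · rintro ⟨-, h1, h3⟩
        exact ⟨h3.trans (aux h1), h2, h1⟩
    | C =>
      simp only [reduceCtorEq, if_false, Symbol.isLow_C, Symbol.isUp_C, true_and]
      constructor
      · rintro ⟨h1, -, h3⟩
        exact Or.inr ⟨h, by linarith, h1⟩
      · rintro (⟨-, h1, h3⟩ | ⟨-, h1, h3⟩)
        · exact ⟨h3.trans (aux h1), h2, by linarith⟩
        · exact ⟨h3, h2, by linarith⟩
    | D =>
      simp only [reduceCtorEq, if_false, if_true, Symbol.isLow_D, Symbol.isUp_D, true_and,
        Bool.false_eq_true, false_and, false_or]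
      constructor
      · rintro ⟨h1, -, h3⟩
        exact ⟨h, by linarith, h1⟩
      · rintro ⟨-, h1, h3⟩
        exact ⟨h3, h, by linarith⟩

lemma mem_index_low : (2 * z, i) ∈ W.drawing.index ↔ i ∈ places Symbol.isLow (W.str z) := by
  rw [← W.layerStrands_even]; rfl

lemma mem_index_up : (2 * z + 1, i) ∈ W.drawing.index ↔ i ∈ places Symbol.isUp (W.str z) := by
  rw [← W.layerStrands_odd]; rfl

lemma bot_low : W.drawing.bot (2 * z) i = rank Symbol.isLow (W.str z) i :=
  congrFun (W.layerBot_even z) i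

lemma top_up : W.drawing.top (2 * z + 1) i = rank Symbol.isUp (W.str z) i :=
  congrFun (W.layerTop_odd z) i

/-- The part of the curve in a band consists of the strands of this band. -/
lemma mem_bandBoundary_iff {p : Plane} :
    p ∈ bandBoundary W.drawing.region (2 * z) (2 * z + 2) ↔ ∃ i < (W.str z).length,
      p ∈ strandSet (2 * z) (2 * z + 1) (2 * z + 2) (letter (W.str z) i) (W.abscissa z i) := by
  rw [bandBoundary, Set.mem_ofPred_eq, Drawing.frontier_region]
  constructor
  · rintro ⟨hp, h1, h2⟩
    obtain ⟨⟨t, i⟩, hi, hpi⟩ := mem_iUnion₂.1 hp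
    have a1 := hpi.1
    have a2 := hpi.2.1
    have a3 := hpi.2.2
    dsimp only at a1 a2 a3
    have b1 : (t : ℝ) ≤ ((2 * z + 2 : ℤ) : ℝ) := by push_cast; linarith
    have b2 : ((2 * z : ℤ) : ℝ) ≤ ((t + 1 : ℤ) : ℝ) := by push_cast; linarith
    have b3 : t ≤ 2 * z + 2 := by exact_mod_cast b1
    have b4 : 2 * z ≤ t + 1 := by exact_mod_cast b2
    rcases (by omega : t = 2 * z ∨ t = 2 * z + 1 ∨ t = 2 * (z - 1) + 1 ∨ t = 2 * (z + 1)) with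
      rfl | rfl | rfl | rfl
    · have hi' := mem_index_low.1 hi
      have hl := (mem_places.1 hi').1
      exact ⟨i, hl, (mem_strandSet_iff hl).2 (Or.inl ⟨hi', hpi⟩)⟩
    · have hi' := mem_index_up.1 hi
      have hl := (mem_places.1 hi').1
      exact ⟨i, hl, (mem_strandSet_iff hl).2 (Or.inr ⟨hi', hpi⟩)⟩
    -- A strand of the band below reaches this band only in its upper end. By balance some strand of
    -- this band has the same rank there, hence the same point; the next case treats the band above
    -- in the same way.
    · have hi' := mem_places.1 (mem_index_up.1 hi)
      have hlt := rank_lt_countP hi'.1 hi'.2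
      rw [← W.balance, sub_add_cancel] at hlt
      obtain ⟨j, hj, hP, hr⟩ := exists_rank_eq _ _ _ hlt
      refine ⟨j, hj, (mem_strandSet_iff hj).2 (Or.inl ⟨mem_places.2 ⟨hj, hP⟩, ?_⟩)⟩
      have hy : p.2 = ((2 * z : ℤ) : ℝ) := by push_cast at a2 ⊢; linarith
      refine ⟨hy.ge, by rw [hy]; simp, ?_⟩
      dsimp only
      rw [hy, Drawing.X_bot, bot_low, hr, a3, hy,
        show ((2 * z : ℤ) : ℝ) = ((2 * (z - 1) + 1 : ℤ) : ℝ) + 1 by push_cast; ring,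
        Drawing.X_top, top_up]
    · have hi' := mem_places.1 (mem_index_low.1 hi)
      have hlt := rank_lt_countP hi'.1 hi'.2
      rw [W.balance] at hlt
      obtain ⟨j, hj, hP, hr⟩ := exists_rank_eq _ _ _ hlt
      refine ⟨j, hj, (mem_strandSet_iff hj).2 (Or.inr ⟨mem_places.2 ⟨hj, hP⟩, ?_⟩)⟩
      have hy : p.2 = ((2 * (z + 1) : ℤ) : ℝ) := by push_cast at a1 ⊢; linarith
      have hy' : ((2 * (z + 1) : ℤ) : ℝ) = ((2 * z + 1 : ℤ) : ℝ) + 1 := by push_cast; ring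
      refine ⟨by rw [hy, hy']; simp, by rw [hy, hy'], ?_⟩
      dsimp only
      rw [a3, hy, Drawing.X_bot, bot_low, ← hr, hy', Drawing.X_top, top_up]
  · rintro ⟨i, hi, hp⟩
    rcases (mem_strandSet_iff hi).1 hp with ⟨h, hp⟩ | ⟨h, hp⟩
    · refine ⟨mem_iUnion₂.2 ⟨_, mem_index_low.2 h, hp⟩, ?_, ?_⟩
      · simpa using hp.1
      · have := hp.2.1
        push_cast at this
        linarith
    · refine ⟨mem_iUnion₂.2 ⟨_, mem_index_up.2 h, hp⟩, ?_, ?_⟩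
      · have := hp.1
        push_cast at this
        linarith
      · have := hp.2.1
        push_cast at this
        linarith

/-- Ranks are injective on both sides of an outer level, so the curve passes through it without
turning. -/
lemma not_isCritical_even (W : BandStrings) (z : ℤ) :
    ¬ IsCritical (frontier W.drawing.region) (2 * z) := by
  rw [Drawing.frontier_region]
  have := Drawing.not_isCritical_level (D := W.drawing) (t := 2 * z) ?_ ?_
  · simpa using this
  · change InjOn (W.layerBot (2 * z)) (W.layerStrands (2 * z))
    rw [layerBot_even, layerStrands_even]
    exact injOn_rank
  · change InjOn (W.layerTop (2 * z - 1)) (W.layerStrands (2 * z - 1))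
    rw [show 2 * z - 1 = 2 * (z - 1) + 1 by ring, layerTop_odd, layerStrands_odd]
    exact injOn_rank

lemma eq_of_isCritical {c : ℝ} (hc : c ∈ Icc (2 * z : ℝ) (2 * z + 2))
    (h : IsCritical (frontier W.drawing.region) c) : c = 2 * z + 1 := by
  rcases hc.1.eq_or_lt with rfl | h1
  · exact absurd h (W.not_isCritical_even z)
  rcases hc.2.eq_or_lt with rfl | h2
  · have := W.not_isCritical_even (z + 1)
    push_cast at this
    rw [mul_add, mul_one] at this
    exact absurd h this
  rw [Drawing.frontier_region] at h
  rcases lt_trichotomy c (2 * z + 1) with h3 | h3 | h3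
  · exact absurd h (Drawing.not_isCritical_of_lt (t := 2 * z) (by push_cast; linarith)
      (by push_cast; linarith))
  · exact h3
  · exact absurd h (Drawing.not_isCritical_of_lt (t := 2 * z + 1) (by push_cast; linarith)
      (by push_cast; linarith))

lemma isUnicritical (W : BandStrings) (z : ℤ) :
    IsUnicritical W.drawing.region (2 * z) (2 * z + 2) := by
  refine ⟨by linarith, W.not_isCritical_even z, ?_, ?_⟩
  · have := W.not_isCritical_even (z + 1)
    push_cast at this
    rwa [mul_add, mul_one] at this
  · rintro c ⟨hc, hc'⟩ d ⟨hd, hd'⟩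
    rw [eq_of_isCritical hc hc', eq_of_isCritical hd hd']

lemma lt_of_mem_strandSet {i j : ℕ} (hij : i < j) (hj : j < (W.str z).length) {p q : Plane}
    (hp : p ∈ strandSet (2 * z) (2 * z + 1) (2 * z + 2) (letter (W.str z) i) (W.abscissa z i))
    (hq : q ∈ strandSet (2 * z) (2 * z + 1) (2 * z + 2) (letter (W.str z) j) (W.abscissa z j))
    (hpq : p.2 = q.2) (hg : p.2 ≠ 2 * z + 1) : p.1 < q.1 := by
  have hi := hij.trans hj
  rcases (mem_strandSet_iff hi).1 hp with ⟨mi, hp'⟩ | ⟨mi, hp'⟩ <;>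
    rcases (mem_strandSet_iff hj).1 hq with ⟨mj, hq'⟩ | ⟨mj, hq'⟩
  · obtain ⟨a1, a2, a3⟩ := hp'
    have b3 := hq'.2.2
    dsimp only at a1 a2 a3 b3
    rw [a3, b3, ← hpq]
    rcases a1.eq_or_lt with h | h
    · rw [← h, Drawing.X_bot, Drawing.X_bot, bot_low, bot_low, Nat.cast_lt]
      exact rank_lt hi (mem_places.1 mi).2 hij
    · exact Drawing.X_lt (mem_index_low.2 mi) ((mem_index_low (i := j)).2 mj) hij h
        (lt_of_le_of_ne a2 (by push_cast; exact hg))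
  -- Points of equal height in different halves lie on the middle level, which is excluded.
  · have a2 := hp'.2.1
    have b1 := hq'.1
    push_cast at a2 b1
    exact absurd (le_antisymm a2 (hpq ▸ b1)) hg
  · have a2 := hp'.1
    have b1 := hq'.2.1
    push_cast at a2 b1
    exact absurd (le_antisymm (hpq ▸ b1) a2) hg
  · obtain ⟨a1, a2, a3⟩ := hp'
    have b3 := hq'.2.2
    dsimp only at a1 a2 a3 b3
    rw [a3, b3, ← hpq]
    rcases a2.eq_or_lt with h | h
    · rw [h, Drawing.X_top, Drawing.X_top, top_up, top_up, Nat.cast_lt]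
      exact rank_lt hi (mem_places.1 mi).2 hij
    · exact Drawing.X_lt (mem_index_up.2 mi) ((mem_index_up (i := j)).2 mj) hij
        (lt_of_le_of_ne a1 (by push_cast; exact hg.symm)) h

/-- The strands of the band `z`. -/
noncomputable def strip (W : BandStrings) (z : ℤ) :
    Strip W.drawing.region (2 * z) (2 * z + 1) (2 * z + 2) where
  n := (W.str z).length
  ty := letter (W.str z)
  X := W.abscissa z
  lt_mid := by linarith
  mid_lt := by linarith
  ty_ne _ hi := letter_ne_sep (W.sep_notMem z) hi
  continuous_X := continuous_abscissa z
  bandBoundary_eq _ := mem_bandBoundary_iff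
  X_lt _ _ hij hj _ hp _ hq hpq hg := lt_of_mem_strandSet hij hj hp hq hpq hg
  X_le i j hij _ := by
    rw [abscissa_mid, abscissa_mid, Nat.cast_le]
    exact midPos_mono hij.le
  single i _ ht k _ hki := by
    rw [abscissa_mid, abscissa_mid, Nat.cast_inj] at hki
    rcases lt_trichotomy k i with h | h | h
    · obtain ⟨-, e, h'⟩ := (W.even z).midPos_eq_of_lt h hki
      rw [← e, ht] at h'
      simp at h'
    · exact h
    · have := ((W.even z).midPos_eq_of_lt h hki.symm).2.2
      rw [ht] at this
      simp at this
  pair i hi ht := by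
    have hsep := letter_ne_sep (W.sep_notMem z) hi
    obtain ⟨j, hji, hl, hm⟩ := (W.even z).exists_pair (i := i)
      (by cases hl : letter (W.str z) i <;> simp_all)
    refine ⟨j, lt_length_of_letter (hl ▸ hsep), hji, hl, fun k _ => ?_⟩
    rw [abscissa_mid, abscissa_mid, Nat.cast_inj]
    constructor
    -- All three places lie in a set of two consecutive numbers, and `i` and `j` already exhaust it.
    · intro hk
      have h1 := midPos_le (u := W.str z) (i := i)
      have h2 := le_midPos (u := W.str z) (i := i)
      have h3 := midPos_le (u := W.str z) (i := j)
      have h4 := le_midPos (u := W.str z) (i := j)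
      have h5 := midPos_le (u := W.str z) (i := k)
      have h6 := le_midPos (u := W.str z) (i := k)
      omega
    · rintro (rfl | rfl)
      · rfl
      · exact hm
  isUnicritical := W.isUnicritical z
  eq_mid _ hc h := eq_of_isCritical hc h

lemma isCriptString (W : BandStrings) (z : ℤ) :
    IsCriptString W.drawing.region (2 * z) (2 * z + 2) (W.str z) := by
  have := (W.strip z).isCriptString
  convert this using 1
  change _ = (List.range (W.str z).length).map (letter (W.str z))
  refine List.ext_getElem (by simp) fun i h1 h2 => ?_
  simp [letter, h1]

end BandStrings

/-! ### Words -/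

section

variable {w : List Symbol}

lemma stringAt_mem {k : ℕ} (hk : k < numStrings w) : stringAt w k ∈ strings w := by
  rw [stringAt, List.getD_eq_getElem _ _ hk]
  exact List.getElem_mem hk

lemma stringAt_eq_nil {k : ℕ} (hk : numStrings w ≤ k) : stringAt w k = [] :=
  List.getD_eq_default _ _ hk

lemma evennessConditions_stringAt (hw : EvennessConditions w) (k : ℕ) :
    EvennessConditions (stringAt w k) := by
  rcases lt_or_ge k (numStrings w) with hk | hk
  · have e : [Symbol.sep].intercalate (strings w) = w := List.intercalate_splitOn _
    exact ⟨EvennessFor.of_intercalate (by simp) _ (e.symm ▸ hw.1) _ (stringAt_mem hk),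
      EvennessFor.of_intercalate (by simp) _ (e.symm ▸ hw.2) _ (stringAt_mem hk)⟩
  · rw [stringAt_eq_nil hk]
    constructor <;> intro i hi <;> simp at hi

lemma sep_notMem_stringAt (k : ℕ) : Symbol.sep ∉ stringAt w k := by
  rcases lt_or_ge k (numStrings w) with hk | hk
  · exact notMem_of_mem_splitOn _ w _ (stringAt_mem hk)
  · simp [stringAt_eq_nil hk]

/-- The strings of a word that satisfies the conditions of the theorem, attached to bands. -/
def bandStrings (hb : BoundaryConditions w) (he : EvennessConditions w)
    (hbal : BalanceConditions w) : BandStrings where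
  -- Strings are read downwards from height 0: the string `k`, counted from 0, goes to the band `z =
  -- -1 - k`, and all other bands are empty.
  str z := if z < 0 then stringAt w (-1 - z).toNat else []
  n := numStrings w
  range_of_ne z hz := by
    split_ifs at hz with h
    · have : (-1 - z).toNat < numStrings w := by
        by_contra hk
        exact hz (stringAt_eq_nil (not_lt.1 hk))
      omega
    · exact absurd rfl hz
  exists_ne := by
    refine ⟨-1, fun h => ?_⟩
    have h1 := hb.1.1
    have h2 : stringAt w 0 = [] := by simpa using h
    simp [h2] at h1
  even z := by
    split_ifs
    · exact evennessConditions_stringAt he _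
    · constructor <;> intro i hi <;> simp at hi
  sep_notMem z := by
    split_ifs
    · exact sep_notMem_stringAt _
    · simp
  balance z := by
    rw [countP_isLow, countP_isUp]
    rcases lt_trichotomy z (-1) with hz | rfl | hz
    · rw [if_pos (by omega), if_pos (by omega)]
      obtain ⟨k, hk⟩ : ∃ k : ℕ, z = -2 - k := ⟨(-2 - z).toNat, by omega⟩
      rw [show (-1 - (z + 1)).toNat = k by omega, show (-1 - z).toNat = k + 1 by omega]
      rcases lt_trichotomy (k + 1) (numStrings w) with h | h | h
      · exact hbal k h
      -- The last string has no `B` or `C`, so nothing reaches the empty band below it; similarly,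
      -- the first string has no `C` or `D` and sends nothing to the band above it.
      · rw [stringAt_eq_nil h.ge, show k = numStrings w - 1 by omega, hb.2.2.1, hb.2.2.2]
        simp
      · rw [stringAt_eq_nil h.le, stringAt_eq_nil (by omega)]
        simp
    · simp [hb.1.2.1, hb.1.2.2]
    · rw [if_neg (by omega), if_neg (by omega)]
      simp

lemma intercalate_stringAt (w : List Symbol) :
    [Symbol.sep].intercalate (List.ofFn fun k : Fin (numStrings w) => stringAt w k) = w := by
  have : (List.ofFn fun k : Fin (numStrings w) => stringAt w k) = strings w := by
    refine List.ext_getElem (by simp [numStrings]) fun i h1 h2 => ?_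
    simp [stringAt, h2]
  rw [this]
  exact List.intercalate_splitOn _

end

end Cript

/-! ### Assembly of the domain, the levels and the code -/

theorem mainTheorem2 (w : List Cript.Symbol)
    (hboundary : Cript.BoundaryConditions w)
    (hevenness : Cript.EvennessConditions w)
    (hbalance : Cript.BalanceConditions w) :
    Cript.IsCorrect w := by
  let W := Cript.bandStrings hboundary hevenness hbalance
  have hstr (k : ℕ) : W.str (-1 - k) = Cript.stringAt w k := by
    change (if (-1 - k : ℤ) < 0 then Cript.stringAt w (-1 - (-1 - k : ℤ)).toNat else []) = _
    rw [if_pos (by omega), show (-1 - (-1 - k : ℤ)).toNat = k by omega]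
  -- With these levels the `k`-th band from the top is the band `z = -1 - k` of the drawing.
  let h : Fin (Cript.numStrings w + 1) → ℝ := fun k => -2 * (k : ℕ)
  have hlow (k : Fin (Cript.numStrings w)) : h k.succ = 2 * ((-1 - (k : ℕ) : ℤ) : ℝ) := by
    simp only [h, Fin.val_succ]; push_cast; ring
  have hup (k : Fin (Cript.numStrings w)) :
      h k.castSucc = 2 * ((-1 - (k : ℕ) : ℤ) : ℝ) + 2 := by
    simp only [h, Fin.val_castSucc]; push_cast; ring
  refine ⟨W.drawing.region, Cript.Drawing.isPlaneDomain_region, Cript.numStrings w, h,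
    fun k => Cript.stringAt w k, ⟨?_, ?_, ?_⟩, ?_, (Cript.intercalate_stringAt w).symm⟩
  · intro a b hab
    have : ((a : ℕ) : ℝ) < ((b : ℕ) : ℝ) := by exact_mod_cast hab
    simp only [h]
    linarith
  · intro p hp
    have := Cript.Drawing.height_of_mem_region hp
    have h1 : W.drawing.lo = -2 * Cript.numStrings w := rfl
    have h2 : W.drawing.hi = 0 := rfl
    rw [h1, h2] at this
    push_cast at this
    simpa [h] using this
  · intro k
    rw [hlow, hup]
    exact W.isUnicritical _
  · intro k
    rw [hlow, hup]
    change Cript.IsCriptString _ _ _ (Cript.stringAt w k)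
    rw [← hstr]
    exact W.isCriptString _
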